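/- Let $\mathcal X\subset\mathbb R^d$ and let $\nu$ be an ergodic invariant Borel probability measure for $f:\mathcal X\to\mathcal X$ (for instance an ergodic SRB measure). $B(x,r)$ denotes the open ball of radius $r$ about $x$ in $\mathcal X$. Let $\tilde x\in\mathcal X$ be such that $\nu(B(\tilde x,r))>0$ for all $r>0$ and the local dimension $d_\nu=\lim_{r\to0}\frac{\log\nu(B(\tilde x,r))}{\log r}$ exists (as a real number). Assume: (A1) there is a monotonically decreasing sequence $\Theta(j)\to0$ such that for all bounded Lipschitz $\varphi_1,\varphi_2:\mathcal X\to\mathbb R$ and all $j\ge 0$, $\left|\int\varphi_1\cdot\varphi_2\circ f^j\,d\nu-\int\varphi_1\,d\nu\int\varphi_2\,d\nu\right|\le\Theta(j)\|\varphi_1\|_{\mathrm{Lip}}\|\varphi_2\|_{\mathrm{Lip}}$, where $\|\varphi\|_{\mathrm{Lip}}=\sup|\varphi|+\mathrm{Lip}(\varphi)$; (A2) there are $\delta>0$, $r_0>0$ and $C$ such that $|\nu(B(\tilde x,r+\epsilon))-\nu(B(\tilde x,r))|\le C\epsilon^\delta$ for all $0<\epsilon<r<r_0$. For $g:\mathbb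 N\to\mathbb R$ and $\alpha>0$, say that *short returns to $\tilde x$ are lacking with exponent $\alpha$ and window $g$* if there is $\epsilon_1>0$ such that for every sequence of radii $u_n>0$ with $\sum_n\nu(B(\tilde x,u_n))=\infty$ and $\nu(B(\tilde x,u_n))=O(n^{-1+\epsilon_1})$ one has, for all sufficiently large $n$ and all integers $1\le k\le g(n)$, $$\nu\big(B(\tilde x,u_n)\cap f^{-k}B(\tilde x,u_n)\big)\le\nu(B(\tilde x,u_n))^{1+\alpha}.$$ Condition (A3a) with constants $\alpha,\gamma$ is this property with $g(n)=n^\gamma$; condition (A3b) with constants $\alpha,\gamma$ is this property with $g(n)=(\log n)^\gamma$. Let $r_n>0$ be a non-increasing sequence, $B_n=B(\tilde x,r_n)$, $S_n(x)=\sum_{1\le k\le n}1_{B_k}(f^k(x))$ and $E_n=\sum_{1\le k\le n}\nu(B_k)$. 1. Suppose that $\Theta(n)=O(\theta_0^n)$ for some $\theta_0\in(0,1)$, that (A3b) holds at $\tilde x$ with constants $\alpha>0$ and $\gamma>1$, and that $\limsup_n\nu(B_n)(\log n)^{\sigma/\alpha}<\infty$ for some $\sigma>1$. Then for every $\epsilon>0$,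 for $\nu$-a.e. $x$, $$S_n(x)=E_n+O\big(E_n^{1/2}(\log E_n)^{3/2+\epsilon}\big).$$ 2. Suppose that $\Theta(n)=O(n^{-\zeta})$ for some $\zeta>1$, that (A3a) holds at $\tilde x$ with constants $\alpha>0$ and $\gamma>\frac{2\delta^{-1}+1}{\zeta-1}$, that $\limsup_n\nu(B_n)n^{\sigma/\alpha}<\infty$ for some $\sigma>\frac{2\delta^{-1}+1}{\zeta-1}$, and that $E_n\to\infty$. Then for every $\epsilon>0$, for $\nu$-a.e. $x$, $$S_n(x)=E_n+O\big(E_n^{1/2}(\log E_n)^{3/2+\epsilon}\big).$$ Here the $O$-estimate means: there is $C=C(x,\epsilon)$ such that $|S_n(x)-E_n|\le C\,E_n^{1/2}(\log E_n)^{3/2+\epsilon}$ for all $n$ with $E_n\ge2$. -/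

import Mathlib

open MeasureTheory Filter Topology Asymptotics

noncomputable section

/-- The Lipschitz norm `sup |φ| + Lip(φ)`; it is only used for bounded Lipschitz functions. -/
def lipNorm {Y : Type*} [PseudoMetricSpace Y] (φ : Y → ℝ) : ℝ :=
  (⨆ x, |φ x|) + sInf {K : ℝ | 0 ≤ K ∧ ∀ x y, |φ x - φ y| ≤ K * dist x y}

/-- A function with finite Lipschitz norm. -/
def IsBoundedLipschitz {Y : Type*} [PseudoMetricSpace Y] (φ : Y → ℝ) : Prop :=
  (∃ M : ℝ, ∀ x, |φ x| ≤ M) ∧ ∃ K : ℝ, 0 ≤ K ∧ ∀ x y, |φ x - φ y| ≤ K * dist x y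

/-- Decay of correlations, Lipschitz against Lipschitz, with the monotone rate
function `Θ` tending to zero. -/
structure DecayOfCorrelations {Y : Type*} [PseudoMetricSpace Y] [MeasurableSpace Y]
    (f : Y → Y) (ν : Measure Y) (Θ : ℕ → ℝ) : Prop where
  antitone : Antitone Θ
  tendsto_zero : Tendsto Θ atTop (𝓝 0)
  correlation_le : ∀ φ₁ φ₂ : Y → ℝ, IsBoundedLipschitz φ₁ → IsBoundedLipschitz φ₂ → ∀ j : ℕ,
    |(∫ x, φ₁ x * φ₂ (f^[j] x) ∂ν) - (∫ x, φ₁ x ∂ν) * (∫ x, φ₂ x ∂ν)|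
      ≤ Θ j * lipNorm φ₁ * lipNorm φ₂

/-- The pointwise local dimension of `ν` at `x` exists and equals the real number `D`. The
positivity of the measures of the balls makes `log ν(B(x,r))` meaningful. -/
def HasLocalDimension {Y : Type*} [PseudoMetricSpace Y] [MeasurableSpace Y]
    (ν : Measure Y) (x : Y) (D : ℝ) : Prop :=
  (∀ r : ℝ, 0 < r → 0 < ν (Metric.ball x r)) ∧
  Tendsto (fun r : ℝ => Real.log (ν.real (Metric.ball x r)) / Real.log r) (𝓝[>] 0) (𝓝 D)

/-- Regularity of `ν` on shrinking annuli about `x`, with exponent `δ > 0`. -/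
def AnnulusRegular {Y : Type*} [PseudoMetricSpace Y] [MeasurableSpace Y]
    (ν : Measure Y) (x : Y) (δ : ℝ) : Prop :=
  0 < δ ∧ ∃ r₀ : ℝ, 0 < r₀ ∧ ∃ C : ℝ, ∀ ε r : ℝ, 0 < ε → ε < r → r < r₀ →
    |ν.real (Metric.ball x (r + ε)) - ν.real (Metric.ball x r)| ≤ C * ε ^ δ

/-- Lack of short returns to `x` with exponent `α` and return-time window `1 ≤ k ≤ g n`: there is
`ε₁ > 0` such that every sequence of balls about `x` with divergent sum of measures and with
measures `O(n ^ (-1 + ε₁))` satisfies `ν(B ∩ f⁻ᵏ B) ≤ ν(B) ^ (1 + α)` in the window, for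
all large `n`. -/
def LacksShortReturns {Y : Type*} [PseudoMetricSpace Y] [MeasurableSpace Y]
    (f : Y → Y) (ν : Measure Y) (x : Y) (α : ℝ) (g : ℕ → ℝ) : Prop :=
  ∃ ε₁ : ℝ, 0 < ε₁ ∧ ∀ r : ℕ → ℝ, (∀ n, 0 < r n) →
    ∑' n, ν (Metric.ball x (r n)) = ⊤ →
    (fun n : ℕ => ν.real (Metric.ball x (r n))) =O[atTop] (fun n : ℕ => (n : ℝ) ^ (-1 + ε₁)) →
    ∀ᶠ n : ℕ in atTop, ∀ k : ℕ, 1 ≤ k → (k : ℝ) ≤ g n →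
      ν.real (Metric.ball x (r n) ∩ f^[k] ⁻¹' Metric.ball x (r n))
        ≤ ν.real (Metric.ball x (r n)) ^ (1 + α)

/-- Lack of short returns with window `g n = n ^ γ`. -/
def LacksShortReturnsPoly {Y : Type*} [PseudoMetricSpace Y] [MeasurableSpace Y]
    (f : Y → Y) (ν : Measure Y) (x : Y) (α γ : ℝ) : Prop :=
  LacksShortReturns f ν x α (fun n => (n : ℝ) ^ γ)

/-- Lack of short returns with window `g n = (log n) ^ γ`. -/
def LacksShortReturnsLog {Y : Type*} [PseudoMetricSpace Y] [MeasurableSpace Y]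
    (f : Y → Y) (ν : Measure Y) (x : Y) (α γ : ℝ) : Prop :=
  LacksShortReturns f ν x α (fun n => (Real.log n) ^ γ)

/-- `S_n(x) = ∑_{1 ≤ k ≤ n} 1_{B_k}(f^k x)`. -/
def hitCount {Y : Type*} (f : Y → Y) (B : ℕ → Set Y) (n : ℕ) (x : Y) : ℝ :=
  ∑ k ∈ Finset.Icc 1 n, (B k).indicator (fun _ => (1 : ℝ)) (f^[k] x)

/-- `E_n = ∑_{1 ≤ k ≤ n} ν(B_k)`. -/
def expectedHits {Y : Type*} [MeasurableSpace Y] (ν : Measure Y) (B : ℕ → Set Y) (n : ℕ) : ℝ :=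
  ∑ k ∈ Finset.Icc 1 n, ν.real (B k)

/-- For every `ε > 0`, almost surely `S_n = E_n + O(E_n^{1/2} (log E_n)^{3/2 + ε})`, the implied
constant depending on the point. The estimate is required at all `n` with `E_n ≥ 2` (this keeps
`log E_n` away from `0`); when `E_n → ∞` these are all but finitely many `n`. -/
def StrongBorelCantelliEstimate {Y : Type*} [MeasurableSpace Y]
    (f : Y → Y) (ν : Measure Y) (B : ℕ → Set Y) : Prop :=
  ∀ ε : ℝ, 0 < ε → ∀ᵐ x ∂ν, ∃ C : ℝ, ∀ n : ℕ, 2 ≤ expectedHits ν B n →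
    |hitCount f B n x - expectedHits ν B n|
      ≤ C * (expectedHits ν B n ^ (1 / 2 : ℝ) * Real.log (expectedHits ν B n) ^ (3 / 2 + ε))

end

/-! The estimate is a second moment argument. If the variance of every block of hits is at most a
constant times the expected number of hits in that block, the Gál–Koksma–Sprindzuk method
(`gal_koksma`) gives the almost sure error `E^{1/2} (log E)^{3/2+ε}`. It therefore suffices to bound
the covariance of hits at times `i < j` by terms charged to `ν(B_i)` and to `ν(B_j)`, with
coefficients summable in the gap `j - i` (`strongBorelCantelliEstimate_of_covariance`).

In `strongBorelCantelliEstimate_of_window` the gaps are split at a window attached to the ball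
rather than to the time: with `m ≈ 1/ν(B_i)`, gaps up to `g m` are short. There the lack of short
returns gives at most `ν(B_i)^{1+α}` for each gap, and since `g m = O(m^α)` the whole window costs
`O(ν(B_i))`. For a longer gap `k`, both indicators are replaced by Lipschitz cutoffs of width `c k`;
annulus regularity pays for the smoothing and decay of correlations for the rest. Since `k` exceeds
`g m`, a small factor in `k` can be traded for `1/m ≈ ν(B_i)`.

This requires the short return bound for all balls of measure about `1/m` simultaneously, while the
hypothesis speaks of one sequence at a time; `LacksShortReturns.uniform` bridges this by a sequence
of worst balls.

In the polynomial case, divergence of `E_n` forces `σ ≤ α`. If the critical exponent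
`(2δ⁻¹+1)/(ζ-1)` is below one, the window can be shrunk to an exponent below both `1` and `α`.
Otherwise `α` and `γ` both exceed one, and nonnegativity of a variance contradicts the lack of short
returns (`not_lacksShortReturns_of_long_window`). -/

section
-- Measures of balls about the centre, and uniform lack of short returns.
variable {Y : Type*} [PseudoMetricSpace Y] [MeasurableSpace Y]

theorem measureReal_ball_mono (ν : Measure Y) [IsProbabilityMeasure ν] (x : Y) {r s : ℝ}
    (h : r ≤ s) : ν.real (Metric.ball x r) ≤ ν.real (Metric.ball x s) :=
  measureReal_mono (Metric.ball_subset_ball h)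

/-- An annulus-regular measure without atom at the centre has balls of measure `O(r ^ δ)`. -/
theorem AnnulusRegular.exists_ball_le {ν : Measure Y} [IsProbabilityMeasure ν] {x : Y} {δ : ℝ}
    (h : AnnulusRegular ν x δ) (h0 : ∀ η : ℝ, 0 < η → ∃ ρ : ℝ, 0 < ρ ∧ ν.real (Metric.ball x ρ) < η) :
    ∃ r₀ : ℝ, 0 < r₀ ∧ ∃ C : ℝ, 0 ≤ C ∧ ∀ r, 0 < r → r < r₀ →
      ν.real (Metric.ball x r) ≤ C * r ^ δ := by
  obtain ⟨hδ, r₀, hr₀, C, hC⟩ := h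
  have hq : (2 / 3 : ℝ) ^ δ < 1 := Real.rpow_lt_one (by norm_num) (by norm_num) hδ
  set C₀ := max C 0
  -- The sum of the geometric series of annulus bounds over the radii `(2/3)^n r`.
  set C₁ := C₀ / (1 - (2 / 3 : ℝ) ^ δ) with hC₁
  have hC₁0 : 0 ≤ C₁ := div_nonneg (le_max_right _ _) (by linarith)
  refine ⟨r₀, hr₀, C₁, hC₁0, fun r hr hrr => ?_⟩
  -- The ratio `2/3` makes the annulus width `s/3` smaller than the inner radius `2s/3`, as
  -- regularity requires; halving the radius would just fail.
  have hstep : ∀ s, 0 < s → s < r₀ → ν.real (Metric.ball x s) - C₁ * s ^ δ ≤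
      ν.real (Metric.ball x (2 / 3 * s)) - C₁ * (2 / 3 * s) ^ δ := by
    intro s hs hsr
    have h1 := hC (s / 3) (2 / 3 * s) (by positivity) (by linarith) (by linarith)
    have h2 : 2 / 3 * s + s / 3 = s := by ring
    rw [h2] at h1
    have h3 := (le_abs_self _).trans h1
    have h4 : C * (s / 3) ^ δ ≤ C₀ * s ^ δ := by
      have : (s / 3) ^ δ ≤ s ^ δ := Real.rpow_le_rpow (by positivity) (by linarith) hδ.le
      calc C * (s / 3) ^ δ ≤ C₀ * (s / 3) ^ δ := by gcongr; exact le_max_left _ _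
        _ ≤ _ := by gcongr
    have h5 : C₁ * s ^ δ - C₁ * (2 / 3 * s) ^ δ = C₀ * s ^ δ := by
      rw [Real.mul_rpow (by norm_num) hs.le, hC₁]
      have : 1 - (2 / 3 : ℝ) ^ δ ≠ 0 := by linarith
      field_simp
    linarith
  have hiter : ∀ n : ℕ, ν.real (Metric.ball x r) - C₁ * r ^ δ ≤
      ν.real (Metric.ball x ((2 / 3) ^ n * r)) := by
    have : ∀ n : ℕ, ν.real (Metric.ball x r) - C₁ * r ^ δ ≤
      ν.real (Metric.ball x ((2 / 3) ^ n * r)) - C₁ * ((2 / 3) ^ n * r) ^ δ := by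
      intro n
      induction n with
      | zero => simp
      | succ n ih =>
        refine ih.trans ((hstep _ (by positivity) ?_).trans_eq ?_)
        · have : (2 / 3 : ℝ) ^ n ≤ 1 := pow_le_one₀ (by norm_num) (by norm_num)
          nlinarith
        · rw [pow_succ', mul_assoc]
    intro n
    refine (this n).trans ?_
    have : 0 ≤ C₁ * ((2 / 3) ^ n * r) ^ δ := by positivity
    linarith
  refine le_of_forall_pos_le_add fun η hη => ?_
  obtain ⟨ρ, hρ, hρη⟩ := h0 η hη
  obtain ⟨n, hn⟩ := exists_pow_lt_of_lt_one (div_pos hρ hr) (by norm_num : (2 / 3 : ℝ) < 1)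
  rw [lt_div_iff₀ hr] at hn
  have := measureReal_ball_mono ν x hn.le
  linarith [hiter n]

/-- Removes the restriction `ε < r`. If `r ≤ ε`, the larger ball has radius at most `2ε` and
`exists_ball_le` applies; if that radius is too large for it, then `ε ≥ r₁/2` and the trivial bound
`1` is at most `(2ε/r₁)^δ`. -/
theorem AnnulusRegular.exists_annulus_le {ν : Measure Y} [IsProbabilityMeasure ν] {x : Y} {δ : ℝ}
    (h : AnnulusRegular ν x δ) (h0 : ∀ η : ℝ, 0 < η → ∃ ρ : ℝ, 0 < ρ ∧ ν.real (Metric.ball x ρ) < η) :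
    ∃ r₀ : ℝ, 0 < r₀ ∧ ∃ C : ℝ, 0 ≤ C ∧ ∀ r ε, 0 ≤ r → r < r₀ → 0 < ε →
      ν.real (Metric.ball x (r + ε)) ≤ ν.real (Metric.ball x r) + C * ε ^ δ := by
  obtain ⟨r₁, hr₁, C₁, hC₁, hb⟩ := h.exists_ball_le h0
  obtain ⟨hδ, r₂, hr₂, C₂, hC₂⟩ := h
  refine ⟨min r₁ r₂, lt_min hr₁ hr₂, |C₂| + C₁ * 2 ^ δ + (2 / r₁) ^ δ, by positivity, ?_⟩
  intro r ε hr hrr hε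
  have hε' : 0 ≤ ε ^ δ := by positivity
  have p1 : 0 ≤ |C₂| * ε ^ δ := by positivity
  have p2 : 0 ≤ C₁ * 2 ^ δ * ε ^ δ := by positivity
  have p3 : 0 ≤ (2 / r₁) ^ δ * ε ^ δ := by positivity
  have p4 : 0 ≤ ν.real (Metric.ball x r) := measureReal_nonneg
  rw [add_mul, add_mul]
  rcases lt_or_ge ε r with h1 | h1
  · have h2 := (le_abs_self _).trans (hC₂ ε r hε h1 (hrr.trans_le (min_le_right _ _)))
    have h3 : C₂ * ε ^ δ ≤ |C₂| * ε ^ δ := by gcongr; exact le_abs_self _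
    linarith
  · rcases lt_or_ge (r + ε) r₁ with h2 | h2
    · have h3 := hb (r + ε) (by linarith) h2
      have h4 : C₁ * (r + ε) ^ δ ≤ C₁ * 2 ^ δ * ε ^ δ := by
        rw [mul_assoc, ← Real.mul_rpow (by norm_num) hε.le]
        gcongr
        linarith
      linarith
    · have h3 : 1 ≤ (2 / r₁) ^ δ * ε ^ δ := by
        rw [← Real.mul_rpow (by positivity) hε.le]
        apply Real.one_le_rpow _ hδ.le
        rw [div_mul_eq_mul_div, le_div_iff₀ hr₁]
        linarith
      have h4 : ν.real (Metric.ball x (r + ε)) ≤ 1 := measureReal_le_one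
      linarith

/-- Let the radius grow in steps `ε` with `C ε^δ ≤ t`. Each step adds at most `t` to the measure, so
the first step that reaches level `t` cannot pass `2t`. -/
theorem exists_ball_measure_between {ν : Measure Y} [IsProbabilityMeasure ν] {x : Y} {δ : ℝ}
    (hδ : 0 < δ) {r₀ C : ℝ} (hC : 0 ≤ C)
    (h : ∀ r ε, 0 ≤ r → r < r₀ → 0 < ε →
      ν.real (Metric.ball x (r + ε)) ≤ ν.real (Metric.ball x r) + C * ε ^ δ)
    {t : ℝ} (ht : 0 < t) (htr : t ≤ ν.real (Metric.ball x r₀)) :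
    ∃ ρ : ℝ, 0 < ρ ∧ t ≤ ν.real (Metric.ball x ρ) ∧ ν.real (Metric.ball x ρ) ≤ 2 * t := by
  obtain ⟨ε, hε, hεt⟩ : ∃ ε : ℝ, 0 < ε ∧ C * ε ^ δ ≤ t := by
    refine ⟨(t / (C + 1)) ^ δ⁻¹, by positivity, ?_⟩
    rw [Real.rpow_inv_rpow (by positivity) hδ.ne', mul_div_assoc', div_le_iff₀ (by positivity)]
    nlinarith
  have hex : ∃ k : ℕ, t ≤ ν.real (Metric.ball x (k * ε)) := by
    obtain ⟨k, hk⟩ := exists_nat_ge (r₀ / ε)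
    rw [div_le_iff₀ hε] at hk
    exact ⟨k, htr.trans (measureReal_ball_mono ν x hk)⟩
  classical
  have h1 := Nat.find_spec hex
  have h2 := fun m => Nat.find_min hex (m := m)
  set k := Nat.find hex
  have hk : k ≠ 0 := by
    intro hk
    rw [hk] at h1
    simp at h1
    linarith
  obtain ⟨m, hm⟩ := Nat.exists_eq_succ_of_ne_zero hk
  have h3 := h2 m (by omega)
  rw [not_le] at h3
  have hmr : (m : ℝ) * ε < r₀ := by
    by_contra hcon
    have := measureReal_ball_mono ν x (not_lt.mp hcon)
    linarith
  have h4 := h (m * ε) ε (by positivity) hmr hε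
  have h5 : (m : ℝ) * ε + ε = k * ε := by rw [hm]; push_cast; ring
  rw [h5] at h4
  have : 0 < (k : ℝ) := by exact_mod_cast Nat.pos_of_ne_zero hk
  exact ⟨k * ε, by positivity, h1, by linarith⟩

theorem LacksShortReturns.mono_window {f : Y → Y} {ν : Measure Y} {x : Y} {α : ℝ} {g g' : ℕ → ℝ}
    (h : LacksShortReturns f ν x α g) (hg : ∀ᶠ n in atTop, g' n ≤ g n) :
    LacksShortReturns f ν x α g' := by
  obtain ⟨ε₁, hε₁, H⟩ := h
  refine ⟨ε₁, hε₁, fun r h1 h2 h3 => ?_⟩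
  filter_upwards [H r h1 h2 h3, hg] with n hn hgn k hk hkg using hn k hk (hkg.trans hgn)

/-- Short returns are lacking uniformly over all balls of measure comparable to `1 / n`. -/
theorem LacksShortReturns.uniform {f : Y → Y} {ν : Measure Y} [IsProbabilityMeasure ν] {x : Y}
    {α : ℝ} {g : ℕ → ℝ} (h : LacksShortReturns f ν x α g)
    {t₀ : ℝ} (ht₀ : 0 < t₀) (hex : ∀ t : ℝ, 0 < t → t ≤ t₀ →
      ∃ ρ : ℝ, 0 < ρ ∧ t ≤ ν.real (Metric.ball x ρ) ∧ ν.real (Metric.ball x ρ) ≤ 2 * t) :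
    ∃ N₀ : ℕ, ∀ n ≥ N₀, ∀ ρ : ℝ, 0 < ρ → 1 / ((n : ℝ) + 1) ≤ ν.real (Metric.ball x ρ) →
      ν.real (Metric.ball x ρ) ≤ 2 * (1 / ((n : ℝ) + 1)) → ∀ k : ℕ, 1 ≤ k → (k : ℝ) ≤ g n →
      ν.real (Metric.ball x ρ ∩ f^[k] ⁻¹' Metric.ball x ρ) ≤ ν.real (Metric.ball x ρ) ^ (1 + α) := by
  obtain ⟨ε₁, hε₁, H⟩ := h
  let Adm : ℕ → ℝ → Prop := fun n ρ => 0 < ρ ∧ 1 / ((n : ℝ) + 1) ≤ ν.real (Metric.ball x ρ) ∧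
      ν.real (Metric.ball x ρ) ≤ 2 * (1 / ((n : ℝ) + 1))
  let Good : ℕ → ℝ → Prop := fun n ρ => ∀ k : ℕ, 1 ≤ k → (k : ℝ) ≤ g n →
      ν.real (Metric.ball x ρ ∩ f^[k] ⁻¹' Metric.ball x ρ) ≤ ν.real (Metric.ball x ρ) ^ (1 + α)
  -- At each `n` choose a ball violating the bound if some ball of the right measure does. The
  -- hypothesis for this one sequence then excludes all violations for large `n`.
  have hu : ∀ n : ℕ, ∃ ρ : ℝ, 0 < ρ ∧ ((1 / ((n : ℝ) + 1) ≤ t₀) → Adm n ρ) ∧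
      ((∃ ρ', Adm n ρ' ∧ ¬ Good n ρ') → ¬ Good n ρ) := by
    intro n
    by_cases hbad : ∃ ρ', Adm n ρ' ∧ ¬ Good n ρ'
    · obtain ⟨ρ, hρ, hρg⟩ := hbad
      exact ⟨ρ, hρ.1, fun _ => hρ, fun _ => hρg⟩
    · by_cases hn : 1 / ((n : ℝ) + 1) ≤ t₀
      · obtain ⟨ρ, hρ, h1, h2⟩ := hex _ (by positivity) hn
        exact ⟨ρ, hρ, fun _ => ⟨hρ, h1, h2⟩, fun h => absurd h hbad⟩
      · exact ⟨1, one_pos, fun h => absurd h hn, fun h => absurd h hbad⟩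
  choose u hu0 huA huG using hu
  have hev : ∀ᶠ n : ℕ in atTop, 1 / ((n : ℝ) + 1) ≤ t₀ :=
    tendsto_one_div_add_atTop_nhds_zero_nat.eventually_le_const ht₀
  have hsum : ∑' n, ν (Metric.ball x (u n)) = ⊤ := by
    by_contra hcon
    have hs : Summable fun n => ν.real (Metric.ball x (u n)) := ENNReal.summable_toReal hcon
    have : Summable fun n : ℕ => 1 / ((n : ℝ) + 1) := by
      refine summable_of_isBigO_nat hs (IsBigO.of_bound 1 ?_)
      filter_upwards [hev] with n hn
      rw [Real.norm_of_nonneg (by positivity), Real.norm_of_nonneg measureReal_nonneg, one_mul]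
      exact (huA n hn).2.1
    refine Real.not_summable_one_div_natCast ((summable_nat_add_iff 1).mp ?_)
    simpa using this
  have hO : (fun n : ℕ => ν.real (Metric.ball x (u n))) =O[atTop]
      (fun n : ℕ => (n : ℝ) ^ (-1 + ε₁)) := by
    refine IsBigO.of_bound 2 ?_
    filter_upwards [hev, eventually_ge_atTop 1] with n hn hn1
    have hn1' : (1 : ℝ) ≤ n := by exact_mod_cast hn1
    rw [Real.norm_of_nonneg measureReal_nonneg, Real.norm_of_nonneg (by positivity)]
    refine (huA n hn).2.2.trans ?_
    have : 1 / ((n : ℝ) + 1) ≤ (n : ℝ) ^ (-1 : ℝ) := by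
      rw [Real.rpow_neg_one, one_div]
      gcongr
      linarith
    have h2 : (n : ℝ) ^ (-1 : ℝ) ≤ (n : ℝ) ^ (-1 + ε₁) :=
      Real.rpow_le_rpow_of_exponent_le hn1' (by linarith)
    linarith
  obtain ⟨N₀, hN₀⟩ := eventually_atTop.mp (H u hu0 hsum hO)
  refine ⟨N₀, fun n hn ρ h1 h2 h3 => ?_⟩
  by_contra hcon
  exact huG n ⟨ρ, ⟨h1, h2, h3⟩, hcon⟩ (hN₀ n hn)

end

/-! ### Lipschitz cutoffs and correlations of balls. -/

section
variable {Y : Type*} [PseudoMetricSpace Y]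

/-- The piecewise linear cutoff equal to `1` on `ball x r` and to `0` off `ball x (r + a)`. -/
noncomputable def ballCutoff (x : Y) (r a : ℝ) (y : Y) : ℝ := max 0 (min 1 ((r + a - dist y x) / a))

theorem ballCutoff_nonneg (x : Y) (r a : ℝ) (y : Y) : 0 ≤ ballCutoff x r a y := le_max_left _ _

theorem ballCutoff_le_one (x : Y) (r a : ℝ) (y : Y) : ballCutoff x r a y ≤ 1 :=
  max_le zero_le_one (min_le_left _ _)

theorem indicator_le_ballCutoff (x : Y) (r : ℝ) {a : ℝ} (ha : 0 < a) (y : Y) :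
    (Metric.ball x r).indicator (fun _ => (1 : ℝ)) y ≤ ballCutoff x r a y := by
  refine Set.indicator_le' (f := fun _ => (1 : ℝ)) (g := ballCutoff x r a) (fun y hy => ?_)
    (fun y _ => ballCutoff_nonneg x r a y) y
  rw [Metric.mem_ball] at hy
  refine le_max_of_le_right (le_min le_rfl ?_)
  rw [le_div_iff₀ ha]
  linarith

theorem ballCutoff_le_indicator (x : Y) (r : ℝ) {a : ℝ} (ha : 0 < a) (y : Y) :
    ballCutoff x r a y ≤ (Metric.ball x (r + a)).indicator (fun _ => (1 : ℝ)) y := by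
  refine Set.le_indicator (f := ballCutoff x r a) (g := fun _ => (1 : ℝ))
    (fun y _ => ballCutoff_le_one x r a y) (fun y hy => ?_) y
  rw [Metric.mem_ball, not_lt] at hy
  refine max_le le_rfl ((min_le_right _ _).trans ?_)
  exact div_nonpos_of_nonpos_of_nonneg (by linarith) ha.le

theorem abs_ballCutoff_sub_le (x : Y) (r : ℝ) {a : ℝ} (ha : 0 < a) (y z : Y) :
    |ballCutoff x r a y - ballCutoff x r a z| ≤ 1 / a * dist y z := by
  unfold ballCutoff
  refine (abs_max_sub_max_le_max _ _ _ _).trans ?_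
  rw [sub_self, abs_zero, max_eq_right (abs_nonneg _)]
  refine (abs_min_sub_min_le_max _ _ _ _).trans ?_
  rw [sub_self, abs_zero, max_eq_right (abs_nonneg _), ← sub_div, abs_div, abs_of_pos ha,
    div_mul_eq_mul_div, one_mul]
  gcongr
  rw [sub_sub_sub_cancel_left, abs_sub_comm]
  exact abs_dist_sub_le y z x

theorem isBoundedLipschitz_ballCutoff (x : Y) (r : ℝ) {a : ℝ} (ha : 0 < a) :
    IsBoundedLipschitz (ballCutoff x r a) :=
  ⟨⟨1, fun y => by rw [abs_of_nonneg (ballCutoff_nonneg x r a y)]; exact ballCutoff_le_one x r a y⟩,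
    1 / a, by positivity, abs_ballCutoff_sub_le x r ha⟩

theorem lipNorm_ballCutoff_le (x : Y) (r : ℝ) {a : ℝ} (ha : 0 < a) :
    lipNorm (ballCutoff x r a) ≤ 1 + 1 / a := by
  have : Nonempty Y := ⟨x⟩
  refine add_le_add (ciSup_le fun y => ?_) (csInf_le ⟨0, fun K hK => hK.1⟩
    ⟨by positivity, abs_ballCutoff_sub_le x r ha⟩)
  rw [abs_of_nonneg (ballCutoff_nonneg x r a y)]
  exact ballCutoff_le_one x r a y

theorem lipNorm_nonneg (φ : Y → ℝ) : 0 ≤ lipNorm φ :=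
  add_nonneg (Real.iSup_nonneg fun _ => abs_nonneg _) (Real.sInf_nonneg fun _ h => h.1)

theorem continuous_ballCutoff (x : Y) (r a : ℝ) : Continuous (ballCutoff x r a) := by
  unfold ballCutoff
  fun_prop

variable [MeasurableSpace Y]

theorem DecayOfCorrelations.nonneg {f : Y → Y} {ν : Measure Y} {Θ : ℕ → ℝ}
    (h : DecayOfCorrelations f ν Θ) (k : ℕ) : 0 ≤ Θ k :=
  h.antitone.le_of_tendsto h.tendsto_zero k

variable [OpensMeasurableSpace Y]

theorem integral_ballCutoff_le (ν : Measure Y) [IsProbabilityMeasure ν] (x : Y) (r : ℝ) {a : ℝ}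
    (ha : 0 < a) : ∫ y, ballCutoff x r a y ∂ν ≤ ν.real (Metric.ball x (r + a)) := by
  rw [← integral_indicator_one Metric.isOpen_ball.measurableSet]
  refine integral_mono_of_nonneg (Eventually.of_forall (ballCutoff_nonneg x r a)) ?_
    (Eventually.of_forall (ballCutoff_le_indicator x r ha))
  exact (integrable_const (1 : ℝ)).indicator Metric.isOpen_ball.measurableSet

/-- Both indicators lie below cutoffs of width `a`. These have Lipschitz norm at most `1 + 1/a`, and
their means are at most the measures of the balls enlarged by `a`. -/
theorem DecayOfCorrelations.measure_inter_le {f : Y → Y} {ν : Measure Y} [IsProbabilityMeasure ν]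
    {Θ : ℕ → ℝ} (h : DecayOfCorrelations f ν Θ) (hf : Measurable f) (x : Y) (r s : ℝ) {a : ℝ}
    (ha : 0 < a) (k : ℕ) :
    ν.real (Metric.ball x r ∩ f^[k] ⁻¹' Metric.ball x s) ≤
      ν.real (Metric.ball x (r + a)) * ν.real (Metric.ball x (s + a))
        + Θ k * (1 + 1 / a) ^ 2 := by
  have hfk := hf.iterate k
  have hm : MeasurableSet (Metric.ball x r ∩ f^[k] ⁻¹' Metric.ball x s) :=
    Metric.isOpen_ball.measurableSet.inter (hfk Metric.isOpen_ball.measurableSet)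
  have h1 : ν.real (Metric.ball x r ∩ f^[k] ⁻¹' Metric.ball x s) ≤
      ∫ y, ballCutoff x r a y * ballCutoff x s a (f^[k] y) ∂ν := by
    rw [← integral_indicator_one hm]
    refine integral_mono_of_nonneg
      (Eventually.of_forall fun y => Set.indicator_nonneg (fun _ _ => zero_le_one) y) ?_
      (Eventually.of_forall fun y => ?_)
    · refine Integrable.of_bound ((continuous_ballCutoff x r a).measurable.mul
        ((continuous_ballCutoff x s a).measurable.comp hfk)).aestronglyMeasurable 1
        (Eventually.of_forall fun y => ?_)
      rw [Real.norm_of_nonneg (mul_nonneg (ballCutoff_nonneg _ _ _ _) (ballCutoff_nonneg _ _ _ _))]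
      exact mul_le_one₀ (ballCutoff_le_one _ _ _ _) (ballCutoff_nonneg _ _ _ _)
        (ballCutoff_le_one _ _ _ _)
    · have e : (Metric.ball x r ∩ f^[k] ⁻¹' Metric.ball x s).indicator (1 : Y → ℝ) y =
          (Metric.ball x r).indicator (fun _ => (1 : ℝ)) y *
          (Metric.ball x s).indicator (fun _ => (1 : ℝ)) (f^[k] y) := by
        rw [Set.inter_indicator_one]; rfl
      change Set.indicator _ (1 : Y → ℝ) y ≤ _
      rw [e]
      exact mul_le_mul (indicator_le_ballCutoff x r ha y) (indicator_le_ballCutoff x s ha _)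
        (Set.indicator_nonneg (fun _ _ => zero_le_one) _) (ballCutoff_nonneg _ _ _ _)
  have h2 := (le_abs_self _).trans (h.correlation_le _ _ (isBoundedLipschitz_ballCutoff x r ha)
    (isBoundedLipschitz_ballCutoff x s ha) k)
  have h3 : (∫ y, ballCutoff x r a y ∂ν) * (∫ y, ballCutoff x s a y ∂ν) ≤
      ν.real (Metric.ball x (r + a)) * ν.real (Metric.ball x (s + a)) :=
    mul_le_mul (integral_ballCutoff_le ν x r ha) (integral_ballCutoff_le ν x s ha)
      (integral_nonneg (ballCutoff_nonneg _ _ _)) measureReal_nonneg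
  have h4 : Θ k * lipNorm (ballCutoff x r a) * lipNorm (ballCutoff x s a) ≤
      Θ k * (1 + 1 / a) ^ 2 := by
    rw [pow_two, ← mul_assoc]
    have := h.nonneg k
    exact mul_le_mul (mul_le_mul_of_nonneg_left (lipNorm_ballCutoff_le x r ha) this)
      (lipNorm_ballCutoff_le x s ha) (lipNorm_nonneg _) (by positivity)
  linarith

end

/-! ### Variance of the number of hits. -/

section variance

theorem sum_indicator_gap_le (s : Finset ℕ) (a : ℕ → ℝ) (C : ℝ)
    (h : ∀ F : Finset ℕ, (∀ k ∈ F, 1 ≤ k) → ∑ k ∈ F, a k ≤ C) (i : ℕ) :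
    ∑ j ∈ s, (if i < j then a (j - i) else 0) ≤ C := by
  rw [← Finset.sum_filter, ← Finset.sum_image (f := a) (g := fun j => j - i)]
  · refine h _ fun k hk => ?_
    simp only [Finset.mem_image, Finset.mem_filter] at hk
    omega
  · intro x hx y hy hxy
    simp only [Finset.coe_filter, Set.mem_ofPred_eq] at hx hy hxy
    omega

theorem sum_indicator_gap_le' (s : Finset ℕ) (a : ℕ → ℝ) (C : ℝ)
    (h : ∀ F : Finset ℕ, (∀ k ∈ F, 1 ≤ k) → ∑ k ∈ F, a k ≤ C) (j : ℕ) :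
    ∑ i ∈ s, (if i < j then a (j - i) else 0) ≤ C := by
  rw [← Finset.sum_filter, ← Finset.sum_image (f := a) (g := fun i => j - i)]
  · refine h _ fun k hk => ?_
    simp only [Finset.mem_image, Finset.mem_filter] at hk
    omega
  · intro x hx y hy hxy
    simp only [Finset.coe_filter, Set.mem_ofPred_eq] at hx hy hxy
    omega

/-- A symmetric array whose entries above the diagonal are controlled by summable rows and columns
has its sum over a square block bounded by the block sum of `v`. -/
theorem sum_sum_le_of_gap_bound (s : Finset ℕ) (c : ℕ → ℕ → ℝ) (hsymm : ∀ i j, c i j = c j i)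
    (v : ℕ → ℝ) (hv : ∀ i, 0 ≤ v i) (hdiag : ∀ i ∈ s, c i i ≤ v i)
    (A : ℕ → ℕ → ℝ) (B : ℕ → ℝ) (C : ℝ)
    (hA : ∀ i ∈ s, ∀ F : Finset ℕ, (∀ k ∈ F, 1 ≤ k) → ∑ k ∈ F, A i k ≤ C)
    (hB : ∀ F : Finset ℕ, (∀ k ∈ F, 1 ≤ k) → ∑ k ∈ F, B k ≤ C)
    (hc : ∀ i ∈ s, ∀ j ∈ s, i < j → c i j ≤ A i (j - i) * v i + B (j - i) * v j) :
    ∑ i ∈ s, ∑ j ∈ s, c i j ≤ (1 + 4 * C) * ∑ i ∈ s, v i := by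
  -- The term charged to `v i` is summed over `j` with `i` fixed, so its coefficient may depend on
  -- `i`. The term charged to `v j` is summed over `i`, so its coefficient depends on the gap alone.
  set P : ℕ → ℕ → ℝ := fun i j => v i * (if i < j then A i (j - i) else 0) +
    v j * (if i < j then B (j - i) else 0) with hP
  have hpt : ∀ i ∈ s, ∀ j ∈ s, c i j ≤ (if i = j then v i else 0) + P i j + P j i := by
    intro i hi j hj
    rcases lt_trichotomy i j with h | h | h
    · have := hc i hi j hj h
      simp only [hP, h, h.ne, h.not_gt, if_true, if_false]
      linarith
    · subst h
      simpa [hP] using hdiag i hi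
    · have := hc j hj i hi h
      rw [hsymm]
      simp only [hP, h, h.ne', h.not_gt, if_true, if_false]
      linarith
  have hPs : ∑ i ∈ s, ∑ j ∈ s, P i j ≤ 2 * C * ∑ i ∈ s, v i := by
    have h1 : ∑ i ∈ s, ∑ j ∈ s, v i * (if i < j then A i (j - i) else 0) ≤ C * ∑ i ∈ s, v i := by
      rw [Finset.mul_sum]
      refine Finset.sum_le_sum fun i hi => ?_
      rw [← Finset.mul_sum, mul_comm C]
      exact mul_le_mul_of_nonneg_left (sum_indicator_gap_le s (A i) C (hA i hi) i) (hv i)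
    have h2 : ∑ i ∈ s, ∑ j ∈ s, v j * (if i < j then B (j - i) else 0) ≤ C * ∑ i ∈ s, v i := by
      rw [Finset.sum_comm, Finset.mul_sum]
      refine Finset.sum_le_sum fun j _ => ?_
      rw [← Finset.mul_sum, mul_comm C]
      exact mul_le_mul_of_nonneg_left (sum_indicator_gap_le' s B C hB j) (hv j)
    simp only [hP, Finset.sum_add_distrib]
    linarith
  calc ∑ i ∈ s, ∑ j ∈ s, c i j ≤ ∑ i ∈ s, ∑ j ∈ s, ((if i = j then v i else 0) + P i j + P j i) :=
        Finset.sum_le_sum fun i hi => Finset.sum_le_sum fun j hj => hpt i hi j hj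
    _ = ∑ i ∈ s, v i + ∑ i ∈ s, ∑ j ∈ s, P i j + ∑ i ∈ s, ∑ j ∈ s, P i j := by
        simp only [Finset.sum_add_distrib]
        rw [Finset.sum_comm (f := fun i j => P j i)]
        congr 2
        refine Finset.sum_congr rfl fun i hi => ?_
        rw [Finset.sum_ite_eq, if_pos hi]
    _ ≤ _ := by linarith

theorem measureReal_preimage_inter_preimage {Y : Type*} [MeasurableSpace Y] {f : Y → Y}
    {ν : Measure Y} (hf : MeasurePreserving f ν ν) {s t : Set Y}
    (hs : MeasurableSet s) (ht : MeasurableSet t) {i j : ℕ} (hij : i ≤ j) :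
    ν.real (f^[i] ⁻¹' s ∩ f^[j] ⁻¹' t) = ν.real (s ∩ f^[j - i] ⁻¹' t) := by
  have : f^[i] ⁻¹' s ∩ f^[j] ⁻¹' t = f^[i] ⁻¹' (s ∩ f^[j - i] ⁻¹' t) := by
    rw [Set.preimage_inter, ← Set.preimage_comp, ← Function.iterate_add,
      Nat.sub_add_cancel hij]
  rw [this]
  exact (hf.iterate i).measureReal_preimage
    (hs.inter ((hf.measurable.iterate _) ht)).nullMeasurableSet

/-- The variance of the number of hits, for an invariant measure. -/
theorem integral_sq_sum_hits_eq {Y : Type*} [MeasurableSpace Y] {f : Y → Y} {ν : Measure Y}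
    [IsProbabilityMeasure ν] (hf : MeasurePreserving f ν ν) (B : ℕ → Set Y)
    (hB : ∀ k, MeasurableSet (B k)) (s : Finset ℕ) :
    ∫ x, (∑ k ∈ s, ((B k).indicator (fun _ => (1 : ℝ)) (f^[k] x) - ν.real (B k))) ^ 2 ∂ν
      = ∑ i ∈ s, ∑ j ∈ s,
        (ν.real (f^[i] ⁻¹' B i ∩ f^[j] ⁻¹' B j) - ν.real (B i) * ν.real (B j)) := by
  have hS : ∀ k, MeasurableSet (f^[k] ⁻¹' B k) := fun k => (hf.measurable.iterate k) (hB k)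
  have hSv : ∀ k, ν.real (f^[k] ⁻¹' B k) = ν.real (B k) := fun k =>
    (hf.iterate k).measureReal_preimage (hB k).nullMeasurableSet
  set X : ℕ → Y → ℝ := fun k => (f^[k] ⁻¹' B k).indicator 1 with hX
  have hXe : ∀ k x, (B k).indicator (fun _ => (1 : ℝ)) (f^[k] x) = X k x := fun k x => rfl
  have hXi : ∀ k, Integrable (X k) ν := fun k => (integrable_const (1 : ℝ)).indicator (hS k)
  have hXX : ∀ i j x, X i x * X j x = (f^[i] ⁻¹' B i ∩ f^[j] ⁻¹' B j).indicator 1 x := by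
    intro i j x
    rw [Set.inter_indicator_one]; rfl
  have hXXi : ∀ i j, Integrable (fun x => X i x * X j x) ν := fun i j => by
    simp_rw [hXX]
    exact (integrable_const (1 : ℝ)).indicator ((hS i).inter (hS j))
  have hprod : ∀ i j, ∫ x, (X i x - ν.real (B i)) * (X j x - ν.real (B j)) ∂ν =
      ν.real (f^[i] ⁻¹' B i ∩ f^[j] ⁻¹' B j) - ν.real (B i) * ν.real (B j) := by
    intro i j
    have e : ∀ x, (X i x - ν.real (B i)) * (X j x - ν.real (B j)) =
      X i x * X j x - ν.real (B j) * X i x - ν.real (B i) * X j x + ν.real (B i) * ν.real (B j) :=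
      fun x => by ring
    simp_rw [e]
    have hI : ∀ k, ∫ x, X k x ∂ν = ν.real (B k) := fun k => by
      rw [hX]; simp only; rw [integral_indicator_one (hS k), hSv]
    have I1 : Integrable (fun x => X i x * X j x - ν.real (B j) * X i x) ν :=
      (hXXi i j).sub ((hXi i).const_mul _)
    have I2 : Integrable (fun x => X i x * X j x - ν.real (B j) * X i x - ν.real (B i) * X j x) ν :=
      I1.sub ((hXi j).const_mul _)
    rw [integral_add I2 (integrable_const _), integral_sub I1 ((hXi j).const_mul _),
      integral_sub (hXXi i j) ((hXi i).const_mul _), integral_const_mul, integral_const_mul, hI, hI]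
    simp_rw [hXX]
    rw [integral_indicator_one ((hS i).inter (hS j))]
    simp
    ring
  have hprodi : ∀ i j, Integrable (fun x => (X i x - ν.real (B i)) * (X j x - ν.real (B j))) ν := by
    intro i j
    have e : ∀ x, (X i x - ν.real (B i)) * (X j x - ν.real (B j)) =
      X i x * X j x - ν.real (B j) * X i x - ν.real (B i) * X j x + ν.real (B i) * ν.real (B j) :=
      fun x => by ring
    simp_rw [e]
    exact (((hXXi i j).sub ((hXi i).const_mul _)).sub ((hXi j).const_mul _)).add
      (integrable_const _)
  simp_rw [hXe, pow_two, Finset.sum_mul_sum]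
  rw [integral_finsetSum _ fun i _ => integrable_finsetSum _ fun j _ => hprodi i j]
  simp_rw [integral_finsetSum s fun j _ => hprodi _ j, hprod]

theorem integral_sq_sum_hits_le {Y : Type*} [MeasurableSpace Y] {f : Y → Y} {ν : Measure Y}
    [IsProbabilityMeasure ν] (hf : MeasurePreserving f ν ν) (B : ℕ → Set Y)
    (hB : ∀ k, MeasurableSet (B k)) (s : Finset ℕ)
    (A : ℕ → ℕ → ℝ) (W : ℕ → ℝ) (C : ℝ)
    (hA : ∀ i ∈ s, ∀ F : Finset ℕ, (∀ k ∈ F, 1 ≤ k) → ∑ k ∈ F, A i k ≤ C)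
    (hW : ∀ F : Finset ℕ, (∀ k ∈ F, 1 ≤ k) → ∑ k ∈ F, W k ≤ C)
    (hc : ∀ i ∈ s, ∀ j ∈ s, i < j →
      ν.real (B i ∩ f^[j - i] ⁻¹' B j) - ν.real (B i) * ν.real (B j)
        ≤ A i (j - i) * ν.real (B i) + W (j - i) * ν.real (B j)) :
    ∫ x, (∑ k ∈ s, ((B k).indicator (fun _ => (1 : ℝ)) (f^[k] x) - ν.real (B k))) ^ 2 ∂ν
      ≤ (1 + 4 * C) * ∑ k ∈ s, ν.real (B k) := by
  rw [integral_sq_sum_hits_eq hf B hB s]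
  refine sum_sum_le_of_gap_bound s _ (fun i j => ?_) _ (fun i => measureReal_nonneg) (fun i _ => ?_)
    A W C hA hW (fun i hi j hj hij => ?_)
  · rw [Set.inter_comm, mul_comm]
  · rw [Set.inter_self, (hf.iterate i).measureReal_preimage (hB i).nullMeasurableSet]
    have : 0 ≤ ν.real (B i) * ν.real (B i) := mul_self_nonneg _
    linarith
  · rw [measureReal_preimage_inter_preimage hf (hB i) (hB j) hij.le]
    exact hc i hi j hj hij

end variance

/-! ### The Gál–Koksma strong law. -/

/-- Deleting the binary digits of `j` one at a time writes the increment as a sum over `r` scales,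
each term being zero or the increment over one dyadic block. Cauchy–Schwarz costs the factor `r`;
including all blocks makes the bound independent of `j`. -/
theorem sq_sub_le_dyadic (A : ℕ → ℝ) (r j : ℕ) (hj : j < 2 ^ r) :
    (A j - A 0) ^ 2 ≤ r * ∑ s ∈ Finset.range r, ∑ a ∈ Finset.range (2 ^ (r - s)),
      (A ((a + 1) * 2 ^ s) - A (a * 2 ^ s)) ^ 2 := by
  have htel : A j - A 0 = ∑ s ∈ Finset.range r,
      (A (j / 2 ^ s * 2 ^ s) - A (j / 2 ^ (s + 1) * 2 ^ (s + 1))) := by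
    rw [Finset.sum_range_sub' (fun s => A (j / 2 ^ s * 2 ^ s))]
    simp [Nat.div_eq_of_lt hj]
  rw [htel]
  refine sq_sum_le_card_mul_sum_sq.trans ?_
  rw [Finset.card_range]
  gcongr with s hs
  rw [Finset.mem_range] at hs
  have h1 : j / 2 ^ (s + 1) = j / 2 ^ s / 2 := by rw [pow_succ, Nat.div_div_eq_div_mul]
  have hlt : j / 2 ^ s < 2 ^ (r - s) := by
    rw [Nat.div_lt_iff_lt_mul (by positivity), ← pow_add]
    rwa [Nat.sub_add_cancel hs.le]
  set q := j / 2 ^ s with hq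
  rw [h1]
  rcases Nat.even_or_odd' q with ⟨b, hb | hb⟩
  · have : q / 2 * 2 ^ (s + 1) = q * 2 ^ s := by
      rw [hb, Nat.mul_div_cancel_left _ (by norm_num)]; ring
    rw [this, sub_self]
    simp only [ne_eq, OfNat.ofNat_ne_zero, not_false_eq_true, zero_pow]
    exact Finset.sum_nonneg fun _ _ => sq_nonneg _
  · have h2 : q / 2 = b := by omega
    have h3 : b * 2 ^ (s + 1) = 2 * b * 2 ^ s := by ring
    rw [h2, h3, hb]
    exact Finset.single_le_sum
      (f := fun a => (A ((a + 1) * 2 ^ s) - A (a * 2 ^ s)) ^ 2) (fun _ _ => sq_nonneg _)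
      (Finset.mem_range.mpr (by omega : 2 * b < 2 ^ (r - s)))

/-- The series of the `G r / c r` has finite integral, so it is finite almost everywhere and its sum
bounds every term. -/
theorem ae_bounded_of_summable_integral {Ω : Type*} [MeasurableSpace Ω] {μ : Measure Ω}
    (G : ℕ → Ω → ℝ) (hG0 : ∀ r x, 0 ≤ G r x) (hG : ∀ r, Integrable (G r) μ)
    (c : ℕ → ℝ) (hc : ∀ r, 0 < c r) (b : ℕ → ℝ) (hb : Summable b)
    (hGb : ∀ r, ∫ x, G r x ∂μ ≤ c r * b r) :
    ∀ᵐ x ∂μ, ∃ M : ℝ, 0 ≤ M ∧ ∀ r, G r x ≤ M * c r := by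
  have hint : ∀ r, Integrable (fun x => G r x / c r) μ := fun r => (hG r).div_const _
  have hlin : ∀ r, ∫⁻ x, ENNReal.ofReal (G r x / c r) ∂μ ≤ ENNReal.ofReal (b r) := by
    intro r
    rw [← ofReal_integral_eq_lintegral_ofReal (hint r)
      (Eventually.of_forall fun x => div_nonneg (hG0 r x) (hc r).le)]
    apply ENNReal.ofReal_le_ofReal
    rw [integral_div, div_le_iff₀ (hc r), mul_comm]
    exact hGb r
  have hfin : ∫⁻ x, ∑' r, ENNReal.ofReal (G r x / c r) ∂μ ≠ ⊤ := by
    rw [lintegral_tsum fun r => (hint r).aemeasurable.ennreal_ofReal]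
    refine ne_top_of_le_ne_top ?_ (ENNReal.tsum_le_tsum hlin)
    exact hb.tsum_ofReal_ne_top
  have hae := ae_lt_top' (AEMeasurable.tsum
    fun r => (hint r).aemeasurable.ennreal_ofReal) hfin
  filter_upwards [hae] with x hx
  refine ⟨(∑' r, ENNReal.ofReal (G r x / c r)).toReal, ENNReal.toReal_nonneg, fun r => ?_⟩
  rw [← div_le_iff₀ (hc r)]
  rw [← ENNReal.toReal_ofReal (div_nonneg (hG0 r x) (hc r).le)]
  exact ENNReal.toReal_mono hx.ne (ENNReal.le_tsum r)

/-- At each of the `r` scales the variance bounds telescope to `C E(N(2^r)) ≤ C (2^r + 1)`. The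
power `3 + 2ε` of `r + 1` consists of one factor for the number of scales, one from Cauchy–Schwarz,
and `1 + 2ε` for summability over `r`. -/
theorem sprindzuk_blocks {Ω : Type*} [MeasurableSpace Ω] {μ : Measure Ω}
    (T : ℕ → Ω → ℝ) (hT0 : ∀ x, T 0 x = 0)
    (hTi : ∀ m n, Integrable (fun x => (T n x - T m x) ^ 2) μ)
    (E : ℕ → ℝ) (C : ℝ) (hC : 0 ≤ C)
    (hvar : ∀ m n, m ≤ n → ∫ x, (T n x - T m x) ^ 2 ∂μ ≤ C * (E n - E m))
    (N : ℕ → ℕ) (hN : Monotone N) (hN0 : N 0 = 0) (hE0 : E 0 = 0) (hEN : ∀ j, E (N j) ≤ j + 1)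
    (ε : ℝ) (hε : 0 < ε) :
    ∀ᵐ x ∂μ, ∃ M : ℝ, 0 ≤ M ∧ ∀ r j : ℕ, j < 2 ^ r →
      (T (N j) x) ^ 2 ≤ M * (2 ^ r * ((r : ℝ) + 1) ^ (3 + 2 * ε)) := by
  set G : ℕ → Ω → ℝ := fun r x => ∑ s ∈ Finset.range r, ∑ a ∈ Finset.range (2 ^ (r - s)),
    (T (N ((a + 1) * 2 ^ s)) x - T (N (a * 2 ^ s)) x) ^ 2 with hGdef
  have hGi : ∀ r, Integrable (G r) μ := fun r =>
    integrable_finsetSum _ fun s _ => integrable_finsetSum _ fun a _ => hTi _ _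
  have hGint : ∀ r : ℕ, ∫ x, G r x ∂μ ≤ r * (C * (2 ^ r + 1)) := by
    intro r
    simp only [hGdef]
    rw [integral_finsetSum _ fun s _ => integrable_finsetSum _ fun a _ => hTi _ _]
    have : ∀ s ∈ Finset.range r, ∫ x, ∑ a ∈ Finset.range (2 ^ (r - s)),
        (T (N ((a + 1) * 2 ^ s)) x - T (N (a * 2 ^ s)) x) ^ 2 ∂μ ≤ C * (2 ^ r + 1) := by
      intro s hs
      rw [Finset.mem_range] at hs
      rw [integral_finsetSum _ fun a _ => hTi _ _]
      calc _ ≤ ∑ a ∈ Finset.range (2 ^ (r - s)),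
            C * (E (N ((a + 1) * 2 ^ s)) - E (N (a * 2 ^ s))) :=
            Finset.sum_le_sum fun a _ => hvar _ _ (hN (by gcongr; omega))
        _ = C * E (N (2 ^ r)) := by
            rw [← Finset.mul_sum, Finset.sum_range_sub (fun a => E (N (a * 2 ^ s))), ← pow_add,
              Nat.sub_add_cancel hs.le]
            simp [hN0, hE0]
        _ ≤ _ := by
            gcongr
            simpa using hEN (2 ^ r)
    refine (Finset.sum_le_sum this).trans ?_
    simp
  have hb : Summable fun r : ℕ => 2 * C * (1 / ((r : ℝ) + 1) ^ (1 + 2 * ε)) := by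
    refine Summable.mul_left _ ?_
    have := (summable_nat_add_iff 1).mpr
      (Real.summable_one_div_nat_rpow.mpr (by linarith : 1 < 1 + 2 * ε))
    simpa using this
  have := ae_bounded_of_summable_integral G
    (fun r x => Finset.sum_nonneg fun _ _ => Finset.sum_nonneg fun _ _ => sq_nonneg _) hGi
    (fun r => 2 ^ r * ((r : ℝ) + 1) ^ (2 + 2 * ε)) (fun r => by positivity) _ hb (by
      intro r
      refine (hGint r).trans ?_
      have h1 : ((r : ℝ) + 1) ^ (2 + 2 * ε) = (r + 1) * ((r : ℝ) + 1) ^ (1 + 2 * ε) := by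
        rw [← Real.rpow_one_add' (by positivity) (by positivity)]
        ring_nf
      have h2 : 0 < ((r : ℝ) + 1) ^ (1 + 2 * ε) := by positivity
      rw [h1]
      have h3 : (1 : ℝ) ≤ 2 ^ r := one_le_pow₀ (by norm_num)
      calc (r : ℝ) * (C * (2 ^ r + 1)) ≤ (r + 1) * (C * (2 ^ r + 2 ^ r)) := by gcongr; linarith
        _ = _ := by field_simp; ring)
  filter_upwards [this] with x ⟨M, hM, hx⟩
  refine ⟨M, hM, fun r j hj => ?_⟩
  have h1 := sq_sub_le_dyadic (fun j => T (N j) x) r j hj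
  simp only [hN0, hT0, sub_zero] at h1
  refine h1.trans ?_
  have h2 : ((r : ℝ) + 1) ^ (3 + 2 * ε) = (r + 1) * ((r : ℝ) + 1) ^ (2 + 2 * ε) := by
    rw [← Real.rpow_one_add' (by positivity) (by positivity)]
    ring_nf
  calc (r : ℝ) * G r x ≤ (r + 1) * (M * (2 ^ r * ((r : ℝ) + 1) ^ (2 + 2 * ε))) := by
        exact mul_le_mul (by linarith) (hx r)
          (Finset.sum_nonneg fun _ _ => Finset.sum_nonneg fun _ _ => sq_nonneg _) (by positivity)
    _ = _ := by rw [h2]; ring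

theorem ae_exists_sum_le_of_bddAbove_integral {Ω : Type*} [MeasurableSpace Ω] {μ : Measure Ω}
    (X : ℕ → Ω → ℝ) (hX : ∀ k, Integrable (X k) μ) (h0 : ∀ k x, 0 ≤ X k x) (B : ℝ)
    (hB : ∀ n, ∑ k ∈ Finset.range n, ∫ x, X k x ∂μ ≤ B) :
    ∀ᵐ x ∂μ, ∃ M : ℝ, ∀ n, ∑ k ∈ Finset.range n, X k x ≤ M := by
  have hv0 : ∀ k, 0 ≤ ∫ x, X k x ∂μ := fun k => integral_nonneg (h0 k)
  have hs : Summable fun k => ∫ x, X k x ∂μ := summable_of_sum_range_le hv0 hB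
  have hfin : ∫⁻ x, ∑' k, ENNReal.ofReal (X k x) ∂μ ≠ ⊤ := by
    rw [lintegral_tsum fun k => (hX k).aemeasurable.ennreal_ofReal]
    have : ∀ k, ∫⁻ x, ENNReal.ofReal (X k x) ∂μ = ENNReal.ofReal (∫ x, X k x ∂μ) := fun k =>
      (ofReal_integral_eq_lintegral_ofReal (hX k) (Eventually.of_forall (h0 k))).symm
    simp_rw [this]
    exact hs.tsum_ofReal_ne_top
  filter_upwards [ae_lt_top' (AEMeasurable.tsum
    fun k => (hX k).aemeasurable.ennreal_ofReal) hfin] with x hx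
  refine ⟨(∑' k, ENNReal.ofReal (X k x)).toReal, fun n => ?_⟩
  rw [← ENNReal.toReal_ofReal (Finset.sum_nonneg fun k _ => h0 k x),
    ENNReal.ofReal_sum_of_nonneg fun k _ => h0 k x]
  exact ENNReal.toReal_mono hx.ne (ENNReal.sum_le_tsum _)

theorem exists_level_times (v : ℕ → ℝ) (h1 : ∀ k, v k ≤ 1)
    (hunb : ∀ B : ℝ, ∃ n, B < ∑ k ∈ Finset.range n, v k) :
    ∃ N : ℕ → ℕ, Monotone N ∧ N 0 = 0 ∧
      ∀ j : ℕ, (j : ℝ) ≤ ∑ k ∈ Finset.range (N j), v k ∧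
        ∑ k ∈ Finset.range (N j), v k ≤ j + 1 ∧
        ∀ n, (j : ℝ) ≤ ∑ k ∈ Finset.range n, v k → N j ≤ n := by
  classical
  have hex : ∀ j : ℕ, ∃ n, (j : ℝ) ≤ ∑ k ∈ Finset.range n, v k := fun j => (hunb j).imp fun _ => le_of_lt
  refine ⟨fun j => Nat.find (hex j), ?_, ?_, ?_⟩
  · intro i j hij
    refine Nat.find_min' _ (le_trans ?_ (Nat.find_spec (hex j)))
    exact_mod_cast hij
  · simp [Nat.find_eq_zero]
  · intro j
    refine ⟨Nat.find_spec (hex j), ?_, fun n hn => Nat.find_min' _ hn⟩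
    change ∑ k ∈ Finset.range (Nat.find (hex j)), v k ≤ j + 1
    rcases Nat.eq_zero_or_eq_succ_pred (Nat.find (hex j)) with h | h
    · rw [h]; simp; positivity
    · have := Nat.find_min (hex j) (m := (Nat.find (hex j)).pred) (by omega)
      rw [h, Nat.succ_eq_add_one, Finset.sum_range_succ]
      have := h1 (Nat.find (hex j)).pred
      linarith

theorem dyadic_level_bound {ε : ℝ} (hε : 0 < ε) :
    ∃ K : ℝ, 0 ≤ K ∧ ∀ (y : ℝ) (j : ℕ), (j : ℝ) ≤ y + 1 → 0 ≤ y → ∃ r : ℕ, j < 2 ^ r ∧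
      (2 : ℝ) ^ r * ((r : ℝ) + 1) ^ (3 + 2 * ε) ≤
        (K * ((y + 2) ^ (1 / 2 : ℝ) * Real.log (y + 2) ^ (3 / 2 + ε))) ^ 2 := by
  have hl2 : 0 < Real.log 2 := Real.log_pos (by norm_num)
  -- With `r = log₂(j+1) + 1`, rounded down, one has `2^r ≤ 2(y+2)` and `r + 1 ≤ (4 / log 2)
  -- log(y+2)`; the constant is the square root of the resulting factors.
  refine ⟨2 ^ (1 / 2 : ℝ) * (4 / Real.log 2) ^ (3 / 2 + ε), by positivity, fun y j hj hy => ?_⟩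
  have hly : Real.log 2 ≤ Real.log (y + 2) := Real.log_le_log (by norm_num) (by linarith)
  refine ⟨Nat.log 2 (j + 1) + 1, (Nat.lt_succ_self j).trans (Nat.lt_pow_succ_log_self (by norm_num) _), ?_⟩
  have h1 : (2 : ℝ) ^ Nat.log 2 (j + 1) ≤ y + 2 := by
    have : 2 ^ Nat.log 2 (j + 1) ≤ j + 1 := Nat.pow_log_le_self 2 (by omega)
    have : (2 : ℝ) ^ Nat.log 2 (j + 1) ≤ j + 1 := by exact_mod_cast this
    linarith
  have h2 : (Nat.log 2 (j + 1) : ℝ) * Real.log 2 ≤ Real.log (y + 2) := by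
    rw [← Real.log_pow]
    exact Real.log_le_log (by positivity) h1
  have h3 : (((Nat.log 2 (j + 1) + 1 : ℕ) : ℝ) + 1) ≤ 4 / Real.log 2 * Real.log (y + 2) := by
    push_cast
    rw [div_mul_eq_mul_div, le_div_iff₀ hl2]
    linarith
  have e1 : ∀ z : ℝ, 0 ≤ z → (z ^ (1 / 2 : ℝ)) ^ 2 = z := fun z hz => by
    rw [← Real.rpow_natCast, ← Real.rpow_mul hz]; norm_num
  have e2 : ∀ z : ℝ, 0 ≤ z → (z ^ (3 / 2 + ε)) ^ 2 = z ^ (3 + 2 * ε) := fun z hz => by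
    rw [← Real.rpow_natCast, ← Real.rpow_mul hz]; congr 1; push_cast; ring
  have hlp : 0 ≤ Real.log (y + 2) := hl2.le.trans hly
  calc (2 : ℝ) ^ (Nat.log 2 (j + 1) + 1) * (((Nat.log 2 (j + 1) + 1 : ℕ) : ℝ) + 1) ^ (3 + 2 * ε)
      ≤ (2 * (y + 2)) * (4 / Real.log 2 * Real.log (y + 2)) ^ (3 + 2 * ε) := by
        rw [pow_succ]
        refine mul_le_mul (by linarith) (Real.rpow_le_rpow (by positivity) h3 (by positivity))
          (by positivity) (by positivity)
    _ = _ := by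
        rw [Real.mul_rpow (by positivity) hlp, mul_pow, mul_pow, mul_pow, e1 _ (by norm_num),
          e1 _ (by linarith), e2 _ (by positivity), e2 _ hlp]
        ring

/-- The Gál–Koksma (Sprindzuk) strong law for `[0, 1]`-valued random variables whose block
variances are bounded by the block means. -/
theorem gal_koksma {Ω : Type*} [MeasurableSpace Ω] {μ : Measure Ω} [IsProbabilityMeasure μ]
    (X : ℕ → Ω → ℝ) (hXm : ∀ k, Measurable (X k)) (h0 : ∀ k x, 0 ≤ X k x) (h1 : ∀ k x, X k x ≤ 1)
    (C : ℝ) (hC : 0 ≤ C)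
    (hvar : ∀ m n, m ≤ n → ∫ x, (∑ k ∈ Finset.Ico m n, (X k x - ∫ y, X k y ∂μ)) ^ 2 ∂μ
      ≤ C * ∑ k ∈ Finset.Ico m n, ∫ y, X k y ∂μ) (ε : ℝ) (hε : 0 < ε) :
    ∀ᵐ x ∂μ, ∃ M : ℝ, 0 ≤ M ∧ ∀ n : ℕ,
      |∑ k ∈ Finset.range n, X k x - ∑ k ∈ Finset.range n, ∫ y, X k y ∂μ| ≤
        M * ((∑ k ∈ Finset.range n, ∫ y, X k y ∂μ + 2) ^ (1 / 2 : ℝ) *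
          Real.log (∑ k ∈ Finset.range n, ∫ y, X k y ∂μ + 2) ^ (3 / 2 + ε)) := by
  have hbd : ∀ k x, ‖X k x‖ ≤ 1 := fun k x => by rw [Real.norm_of_nonneg (h0 k x)]; exact h1 k x
  have hXi : ∀ k, Integrable (X k) μ := fun k =>
    Integrable.of_bound (hXm k).aestronglyMeasurable 1 (Eventually.of_forall (hbd k))
  set v : ℕ → ℝ := fun k => ∫ y, X k y ∂μ with hv
  have hv0 : ∀ k, 0 ≤ v k := fun k => integral_nonneg (h0 k)
  have hv1 : ∀ k, v k ≤ 1 := fun k => by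
    have := integral_mono (hXi k) (integrable_const 1) (h1 k)
    simpa using this
  set E : ℕ → ℝ := fun n => ∑ k ∈ Finset.range n, v k with hE
  have hE0 : ∀ n, 0 ≤ E n := fun n => Finset.sum_nonneg fun k _ => hv0 k
  set w : ℝ → ℝ := fun y => (y + 2) ^ (1 / 2 : ℝ) * Real.log (y + 2) ^ (3 / 2 + ε) with hw
  -- The shift by `2` keeps the weight away from zero, so bounded errors can be absorbed in it.
  have hw0 : ∃ c : ℝ, 0 < c ∧ ∀ y, 0 ≤ y → c ≤ w y := by
    have hl2 : 0 < Real.log 2 := Real.log_pos (by norm_num)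
    refine ⟨2 ^ (1 / 2 : ℝ) * Real.log 2 ^ (3 / 2 + ε), by positivity, fun y hy => ?_⟩
    have : Real.log 2 ≤ Real.log (y + 2) := Real.log_le_log (by norm_num) (by linarith)
    simp only [hw]
    gcongr
    linarith
  obtain ⟨c, hc, hcw⟩ := hw0
  have hS0 : ∀ n x, 0 ≤ ∑ k ∈ Finset.range n, X k x := fun n x => Finset.sum_nonneg fun k _ => h0 k x
  by_cases hunb : ∀ B : ℝ, ∃ n, B < E n
  · obtain ⟨N, hN, hN0, hNj⟩ := exists_level_times v hv1 hunb
    set T : ℕ → Ω → ℝ := fun n x => ∑ k ∈ Finset.range n, (X k x - v k) with hT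
    have hTm : ∀ n, Measurable (T n) := fun n =>
      Finset.measurable_fun_sum _ fun k _ => (hXm k).sub_const _
    have hTb : ∀ n x, |T n x| ≤ n := by
      intro n x
      refine (Finset.abs_sum_le_sum_abs _ _).trans ?_
      have : ∀ k ∈ Finset.range n, |X k x - v k| ≤ 1 := fun k _ => by
        rw [abs_le]; constructor <;> linarith [h0 k x, h1 k x, hv0 k, hv1 k]
      refine (Finset.sum_le_sum this).trans ?_
      simp
    have hsub : ∀ m n, m ≤ n → ∀ x, T n x - T m x = ∑ k ∈ Finset.Ico m n, (X k x - v k) := by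
      intro m n hmn x
      rw [Finset.sum_Ico_eq_sub _ hmn]
    have hTi : ∀ m n, Integrable (fun x => (T n x - T m x) ^ 2) μ := by
      intro m n
      refine Integrable.of_bound (((hTm n).sub (hTm m)).pow_const 2).aestronglyMeasurable
        (((n : ℝ) + m) ^ 2) (Eventually.of_forall fun x => ?_)
      rw [Real.norm_of_nonneg (sq_nonneg _), sq_le_sq, abs_of_nonneg (by positivity : (0 : ℝ) ≤ n + m)]
      exact (abs_sub _ _).trans (add_le_add (hTb n x) (hTb m x))
    have key := sprindzuk_blocks T (fun x => by simp [hT]) hTi E C hC (by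
      intro m n hmn
      simp_rw [hsub m n hmn]
      refine (hvar m n hmn).trans_eq ?_
      rw [Finset.sum_Ico_eq_sub _ hmn]) N hN hN0 (by simp [hE]) (fun j => (hNj j).2.1) ε hε
    obtain ⟨K, hK, hKr⟩ := dyadic_level_bound hε
    filter_upwards [key] with x ⟨M, hM, hx⟩
    have hj : ∀ (y : ℝ) (j : ℕ), (j : ℝ) ≤ y + 1 → 0 ≤ y → |T (N j) x| ≤ √M * (K * w y) := by
      intro y j hjy hy
      obtain ⟨r, hr1, hr2⟩ := hKr y j hjy hy
      have hw' : 0 ≤ w y := hc.le.trans (hcw y hy)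
      refine abs_le_of_sq_le_sq ?_ (by positivity)
      rw [mul_pow, Real.sq_sqrt hM]
      exact (hx r j hr1).trans (mul_le_mul_of_nonneg_left hr2 hM)
    refine ⟨√M * K + 2 / c, by positivity, fun n => ?_⟩
    have hEn := hE0 n
    -- The number of hits is monotone, so it lies between its values at the level times `N j` and `N
    -- (j + 1)`, whose means differ from `E n` by at most `2`.
    set j := ⌊E n⌋₊ with hjdef
    have hj1 : (j : ℝ) ≤ E n := Nat.floor_le hEn
    have hj2 : E n < j + 1 := Nat.lt_floor_add_one _
    have hEm : Monotone E := monotone_nat_of_le_succ fun n => by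
      simp only [hE, Finset.sum_range_succ]; linarith [hv0 n]
    have hSm : Monotone fun n => ∑ k ∈ Finset.range n, X k x := monotone_nat_of_le_succ fun n => by
      simp only [Finset.sum_range_succ]; linarith [h0 n x]
    have hNn : N j ≤ n := (hNj j).2.2 n hj1
    have hnN : n ≤ N (j + 1) := by
      by_contra hcon
      have h3 := hEm (not_le.mp hcon).le
      have h4 := (hNj (j + 1)).1
      push_cast at h4
      change _ ≤ E (N (j + 1)) at h4
      linarith
    have hTe : ∀ n, T n x = ∑ k ∈ Finset.range n, X k x - E n := fun n => by
      simp only [hT, hE, Finset.sum_sub_distrib]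
    have a1 := hj (E n) j (by linarith) hEn
    have a2 := hj (E n) (j + 1) (by push_cast; linarith) hEn
    rw [hTe, abs_le] at a1 a2
    have b1 := hSm hNn
    have b2 := hSm hnN
    have b3 : (j : ℝ) ≤ E (N j) := (hNj j).1
    have b4 : E (N (j + 1)) ≤ j + 1 + 1 := by
      have := (hNj (j + 1)).2.1
      push_cast at this
      exact this
    have b5 : 2 ≤ 2 / c * w (E n) := by
      rw [div_mul_eq_mul_div, le_div_iff₀ hc]
      linarith [hcw (E n) hEn]
    change |∑ k ∈ Finset.range n, X k x - E n| ≤ (√M * K + 2 / c) * w (E n)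
    rw [add_mul, mul_assoc, abs_le]
    simp only at b1 b2
    constructor <;> linarith [a1.1, a2.2]
  -- With bounded means there are no level times; almost surely the total number of hits is then
  -- finite.
  · push Not at hunb
    obtain ⟨B, hB⟩ := hunb
    filter_upwards [ae_exists_sum_le_of_bddAbove_integral X hXi h0 B hB] with x ⟨M, hM⟩
    have hM0 : 0 ≤ M := (hS0 0 x).trans (hM 0)
    have hB0 : 0 ≤ B := (hE0 0).trans (hB 0)
    refine ⟨(M + B) / c, by positivity, fun n => ?_⟩
    change |∑ k ∈ Finset.range n, X k x - E n| ≤ (M + B) / c * w (E n)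
    have b5 : M + B ≤ (M + B) / c * w (E n) := by
      rw [div_mul_eq_mul_div, le_div_iff₀ hc]
      exact mul_le_mul_of_nonneg_left (hcw (E n) (hE0 n)) (by positivity)
    rw [abs_le]
    constructor <;> linarith [hM n, hB n, hS0 n x, hE0 n]

/-! ### From covariance bounds to the strong Borel–Cantelli estimate. -/

theorem sum_cutoff_sub_mem_Icc (u : ℕ → ℝ) (h0 : ∀ k, 0 ≤ u k) (h1 : ∀ k, u k ≤ 1) (n₁ : ℕ)
    (s : Finset ℕ) :
    0 ≤ ∑ k ∈ s, u k - ∑ k ∈ s, (if k < n₁ then 0 else u k) ∧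
      ∑ k ∈ s, u k - ∑ k ∈ s, (if k < n₁ then 0 else u k) ≤ n₁ := by
  have e : ∑ k ∈ s, u k - ∑ k ∈ s, (if k < n₁ then 0 else u k) = ∑ k ∈ s with k < n₁, u k := by
    rw [← Finset.sum_sub_distrib, Finset.sum_filter]
    refine Finset.sum_congr rfl fun k _ => ?_
    split_ifs <;> simp
  rw [e]
  refine ⟨Finset.sum_nonneg fun k _ => h0 k, ?_⟩
  calc ∑ k ∈ s with k < n₁, u k ≤ ∑ k ∈ s with k < n₁, (1 : ℝ) := Finset.sum_le_sum fun k _ => h1 k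
    _ ≤ ∑ k ∈ Finset.range n₁, (1 : ℝ) := by
        refine Finset.sum_le_sum_of_subset_of_nonneg (fun k hk => ?_) fun _ _ _ => zero_le_one
        simpa using (Finset.mem_filter.mp hk).2
    _ = n₁ := by simp

theorem sum_range_succ_eq_sum_Icc (u : ℕ → ℝ) (h : u 0 = 0) (n : ℕ) :
    ∑ k ∈ Finset.range (n + 1), u k = ∑ k ∈ Finset.Icc 1 n, u k := by
  rw [Finset.range_eq_Ico, Finset.sum_eq_sum_Ico_succ_bot (Nat.succ_pos n), h, zero_add]
  rfl

theorem log_weight_shift_le {p : ℝ} (hp : 0 < p) {y z : ℝ} (hy : 0 ≤ y) (hyz : y ≤ z) (hz : 2 ≤ z) :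
    (y + 2) ^ (1 / 2 : ℝ) * Real.log (y + 2) ^ p ≤
      2 ^ (1 / 2 : ℝ) * 2 ^ p * (z ^ (1 / 2 : ℝ) * Real.log z ^ p) := by
  have hl2 : Real.log 2 ≤ Real.log z := Real.log_le_log (by norm_num) hz
  have hl0 : 0 < Real.log 2 := Real.log_pos (by norm_num)
  have h1 : Real.log (y + 2) ≤ 2 * Real.log z := by
    have : Real.log (y + 2) ≤ Real.log (2 * z) := Real.log_le_log (by linarith) (by linarith)
    rw [Real.log_mul (by norm_num) (by linarith)] at this
    linarith
  have h2 : 0 ≤ Real.log (y + 2) := Real.log_nonneg (by linarith)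
  calc (y + 2) ^ (1 / 2 : ℝ) * Real.log (y + 2) ^ p
      ≤ (2 * z) ^ (1 / 2 : ℝ) * (2 * Real.log z) ^ p := by
        gcongr
        linarith
    _ = _ := by
        rw [Real.mul_rpow (by norm_num) (by linarith), Real.mul_rpow (by norm_num) (by linarith)]
        ring

/-- A strong Borel–Cantelli estimate follows from summable covariance bounds for late indices. -/
theorem strongBorelCantelliEstimate_of_covariance {Y : Type*} [MeasurableSpace Y] {f : Y → Y}
    {ν : Measure Y} [IsProbabilityMeasure ν] (hf : MeasurePreserving f ν ν) (B : ℕ → Set Y)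
    (hB : ∀ k, MeasurableSet (B k)) (n₀ : ℕ) (A : ℕ → ℕ → ℝ) (W : ℕ → ℝ) (hW0 : ∀ k, 0 ≤ W k) (C : ℝ)
    (hA : ∀ i ≥ n₀, ∀ F : Finset ℕ, (∀ k ∈ F, 1 ≤ k) → ∑ k ∈ F, A i k ≤ C)
    (hW : ∀ F : Finset ℕ, (∀ k ∈ F, 1 ≤ k) → ∑ k ∈ F, W k ≤ C)
    (hc : ∀ i ≥ n₀, ∀ j, i < j →
      ν.real (B i ∩ f^[j - i] ⁻¹' B j) - ν.real (B i) * ν.real (B j)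
        ≤ A i (j - i) * ν.real (B i) + W (j - i) * ν.real (B j)) :
    StrongBorelCantelliEstimate f ν B := by
  intro ε hε
  have hC : 0 ≤ C := by simpa using hW ∅ (by simp)
  -- The early sets are emptied, which changes both sums by at most `n₁`. Since `n₁ ≥ 1`, index `0`
  -- is emptied too, and sums over `range (n + 1)` agree with sums over `Icc 1 n`.
  set n₁ := n₀ + 1
  set B' : ℕ → Set Y := fun k => if k < n₁ then ∅ else B k with hB'
  have hB'm : ∀ k, MeasurableSet (B' k) := fun k => by
    simp only [hB']; split_ifs
    exacts [MeasurableSet.empty, hB k]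
  set X : ℕ → Y → ℝ := fun k x => (B' k).indicator (fun _ => (1 : ℝ)) (f^[k] x) with hX
  have hXm : ∀ k, Measurable (X k) := fun k =>
    (measurable_const.indicator (hB'm k)).comp (hf.measurable.iterate k)
  have hX0 : ∀ k x, 0 ≤ X k x := fun k x => Set.indicator_nonneg (fun _ _ => zero_le_one) _
  have hX1 : ∀ k x, X k x ≤ 1 := fun k x => Set.indicator_le' (fun _ _ => le_rfl)
    (fun _ _ => zero_le_one) _
  have hXI : ∀ k, ∫ x, X k x ∂ν = ν.real (B' k) := fun k => by
    have e : X k = (f^[k] ⁻¹' B' k).indicator 1 := rfl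
    rw [e, integral_indicator_one ((hf.measurable.iterate k) (hB'm k)),
      (hf.iterate k).measureReal_preimage (hB'm k).nullMeasurableSet]
  have hXe : ∀ k x, X k x = if k < n₁ then 0 else (B k).indicator (fun _ => (1 : ℝ)) (f^[k] x) := by
    intro k x
    simp only [hX, hB']
    split_ifs <;> simp
  have hve : ∀ k, ν.real (B' k) = if k < n₁ then 0 else ν.real (B k) := by
    intro k
    simp only [hB']
    split_ifs <;> simp
  have key := gal_koksma (μ := ν) X hXm hX0 hX1 (1 + 4 * C) (by positivity) (by
    intro m n _
    simp_rw [hXI]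
    refine integral_sq_sum_hits_le hf B' hB'm (Finset.Ico m n)
      (fun i k => if i < n₁ then 0 else A i k) W C (fun i _ F hF => ?_) hW (fun i _ j _ hij => ?_)
    · by_cases hi : i < n₁
      · simpa [hi] using hC
      · simpa [hi] using hA i (by omega) F hF
    · by_cases hi : i < n₁
      · have : B' i = ∅ := if_pos hi
        simp only [this, hi, if_true, Set.empty_inter, measureReal_empty, zero_mul, sub_zero, zero_add]
        exact mul_nonneg (hW0 _) measureReal_nonneg
      · have h1 : B' i = B i := if_neg hi
        have h2 : B' j = B j := if_neg (by omega)
        simp only [h1, h2, hi, if_false]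
        exact hc i (by omega) j hij) ε hε
  have hl2 : 0 < Real.log 2 := Real.log_pos (by norm_num)
  filter_upwards [key] with x ⟨M, hM, hx⟩
  refine ⟨M * (2 ^ (1 / 2 : ℝ) * 2 ^ (3 / 2 + ε)) + n₁ / Real.log 2 ^ (3 / 2 + ε), fun n hn => ?_⟩
  have h := hx (n + 1)
  simp_rw [hXI, hve, hXe] at h
  rw [sum_range_succ_eq_sum_Icc _ (by simp [n₁]), sum_range_succ_eq_sum_Icc _ (by simp [n₁])] at h
  have hS := sum_cutoff_sub_mem_Icc (fun k => (B k).indicator (fun _ => (1 : ℝ)) (f^[k] x))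
    (fun k => Set.indicator_nonneg (fun _ _ => zero_le_one) _)
    (fun k => Set.indicator_le' (fun _ _ => le_rfl) (fun _ _ => zero_le_one) _) n₁ (Finset.Icc 1 n)
  have hE := sum_cutoff_sub_mem_Icc (fun k => ν.real (B k)) (fun k => measureReal_nonneg)
    (fun k => measureReal_le_one) n₁ (Finset.Icc 1 n)
  change 0 ≤ hitCount f B n x - _ ∧ hitCount f B n x - _ ≤ _ at hS
  change 0 ≤ expectedHits ν B n - _ ∧ expectedHits ν B n - _ ≤ _ at hE
  have hE'0 : 0 ≤ ∑ k ∈ Finset.Icc 1 n, (if k < n₁ then 0 else ν.real (B k)) :=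
    Finset.sum_nonneg fun k _ => by split_ifs; exacts [le_rfl, measureReal_nonneg]
  set S' := ∑ k ∈ Finset.Icc 1 n, (if k < n₁ then 0 else (B k).indicator (fun _ => (1 : ℝ)) (f^[k] x))
  set E' := ∑ k ∈ Finset.Icc 1 n, (if k < n₁ then 0 else ν.real (B k))
  set E := expectedHits ν B n
  set S := hitCount f B n x
  have h1 := log_weight_shift_le (p := 3 / 2 + ε) (by positivity) hE'0 (by linarith [hE.1]) hn
  have h2 : (n₁ : ℝ) ≤ n₁ / Real.log 2 ^ (3 / 2 + ε) *
      (E ^ (1 / 2 : ℝ) * Real.log E ^ (3 / 2 + ε)) := by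
    rw [div_mul_eq_mul_div, le_div_iff₀ (by positivity)]
    have h3 : Real.log 2 ^ (3 / 2 + ε) ≤ Real.log E ^ (3 / 2 + ε) :=
      Real.rpow_le_rpow hl2.le (Real.log_le_log (by norm_num) hn) (by positivity)
    have h4 : 1 ≤ E ^ (1 / 2 : ℝ) := Real.one_le_rpow (by linarith) (by norm_num)
    have h5 : 0 < Real.log 2 ^ (3 / 2 + ε) := by positivity
    gcongr
    nlinarith
  have h3 := h.trans (mul_le_mul_of_nonneg_left h1 hM)
  rw [add_mul, mul_assoc M]
  rw [abs_le] at h3 ⊢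
  constructor <;> linarith [h3.1, h3.2, hS.1, hS.2, hE.1, hE.2]

/-! ### Splitting the gaps at a window, and the obstruction to long windows. -/

theorem sum_ite_le_window (t g : ℝ) (ht : 0 ≤ t) (F : Finset ℕ) (hF : ∀ k ∈ F, 1 ≤ k) :
    ∑ k ∈ F, (if (k : ℝ) ≤ g then t else 0) ≤ t * max g 0 := by
  rw [← Finset.sum_filter, Finset.sum_const, nsmul_eq_mul, mul_comm]
  gcongr
  rcases lt_or_ge g 0 with hg | hg
  · rw [Finset.filter_false_of_mem]
    · simp
    · intro k _ hk
      have : (0 : ℝ) ≤ k := by positivity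
      linarith
  · refine le_max_of_le_left ?_
    have : (F.filter fun k : ℕ => (k : ℝ) ≤ g) ⊆ Finset.Icc 1 ⌊g⌋₊ := by
      intro k hk
      rw [Finset.mem_filter] at hk
      exact Finset.mem_Icc.mpr ⟨hF k hk.1, Nat.le_floor hk.2⟩
    have h2 := Finset.card_le_card this
    rw [Nat.card_Icc, Nat.add_sub_cancel] at h2
    exact (Nat.cast_le.mpr h2).trans (Nat.floor_le hg)

section
variable {Y : Type*} [PseudoMetricSpace Y] [MeasurableSpace Y] [OpensMeasurableSpace Y]

/-- Strong Borel–Cantelli estimate for shrinking balls, when short returns are lacking in a window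
`g` beyond which cutoffs at scale `c k` make the correlations summable. -/
theorem strongBorelCantelliEstimate_of_window {f : Y → Y} {ν : Measure Y} [IsProbabilityMeasure ν]
    (hf : MeasurePreserving f ν ν) {x : Y} {δ : ℝ} (hA2 : AnnulusRegular ν x δ)
    (hpos : ∀ r : ℝ, 0 < r → 0 < ν.real (Metric.ball x r)) {Θ : ℕ → ℝ}
    (hA1 : DecayOfCorrelations f ν Θ) {α : ℝ} (hα : 0 < α) {g : ℕ → ℝ}
    (hsr : LacksShortReturns f ν x α g) (G : ℝ) (hG : 0 ≤ G)
    (hg : ∀ᶠ n : ℕ in atTop, g n ≤ G * (n : ℝ) ^ α) (w c : ℕ → ℝ) (hw : Summable w)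
    (hw0 : ∀ k, 0 ≤ w k) (hc : ∀ k, 1 ≤ k → 0 < c k ∧ c k ≤ 1)
    (hcw : ∀ᶠ n : ℕ in atTop, ∀ k : ℕ, 1 ≤ k → g n < k → c k ^ δ ≤ w k ∧
      c k ^ δ * c k ^ δ ≤ w k / n ∧ Θ k / c k ^ 2 ≤ w k / n)
    (r : ℕ → ℝ) (hr : ∀ n, 0 < r n) (hanti : Antitone r)
    (htend : Tendsto (fun n => ν.real (Metric.ball x (r n))) atTop (𝓝 0)) :
    StrongBorelCantelliEstimate f ν (fun n => Metric.ball x (r n)) := by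
  set v : ℕ → ℝ := fun n => ν.real (Metric.ball x (r n)) with hv
  have hv0 : ∀ n, 0 < v n := fun n => hpos _ (hr n)
  have hsmall : ∀ η : ℝ, 0 < η → ∃ ρ : ℝ, 0 < ρ ∧ ν.real (Metric.ball x ρ) < η := fun η hη => by
    obtain ⟨n, hn⟩ := (htend.eventually_lt_const hη).exists
    exact ⟨r n, hr n, hn⟩
  obtain ⟨r₀, hr₀, C, hC, hann⟩ := hA2.exists_annulus_le hsmall
  have hδ := hA2.1
  obtain ⟨N₀, hN₀⟩ := hsr.uniform (hpos r₀ hr₀)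
    fun t ht htr => exists_ball_measure_between hδ hC hann ht htr
  obtain ⟨N₁, hN₁⟩ := eventually_atTop.mp (hg.and hcw)
  set N := max N₀ N₁ + 1 with hN
  obtain ⟨n₀, hn₀⟩ := eventually_atTop.mp ((htend.eventually_lt_const (hpos r₀ hr₀)).and
    (htend.eventually_lt_const (by positivity : (0 : ℝ) < 1 / N)))
  -- The index at which `B_i` is admissible in the uniform short return bound; the window for `B_i`
  -- is `g (m i)`, not `g i`.
  set m : ℕ → ℕ := fun i => ⌊1 / v i⌋₊ with hm
  have hmi : ∀ i ≥ n₀, N ≤ m i ∧ (m i : ℝ) * v i ≤ 1 ∧ 1 / ((m i : ℝ) + 1) ≤ v i ∧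
      v i ≤ 2 * (1 / ((m i : ℝ) + 1)) ∧ 1 / (m i : ℝ) ≤ 2 * v i := by
    intro i hi
    have h1 : N ≤ m i := by
      refine Nat.le_floor ?_
      rw [le_div_iff₀ (hv0 i)]
      have := (hn₀ i hi).2
      rw [lt_div_iff₀ (by positivity)] at this
      change v i * N < 1 at this
      linarith
    have h2 : (m i : ℝ) * v i ≤ 1 := by
      rw [← le_div_iff₀ (hv0 i)]
      exact Nat.floor_le (by have := hv0 i; positivity)
    have h3 : 1 < v i * ((m i : ℝ) + 1) := by
      have := Nat.lt_floor_add_one (1 / v i)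
      rw [div_lt_iff₀ (hv0 i)] at this
      linarith
    have h4 : (1 : ℝ) ≤ m i := by exact_mod_cast (by omega : 1 ≤ m i)
    have h5 := hv0 i
    refine ⟨h1, h2, ?_, ?_, ?_⟩
    · rw [div_le_iff₀ (by positivity)]; exact h3.le
    · rw [mul_one_div, le_div_iff₀ (by positivity)]; nlinarith
    · rw [div_le_iff₀ (by positivity)]; nlinarith
  -- `C` comes from the cross terms of the two enlarged balls, `2C²` from the product of the annulus
  -- errors and `8 = 4 · 2` from the decay term; the factors `2` come from `1/m ≤ 2 v i`.
  set K := C + 2 * C ^ 2 + 8 with hK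
  have hK0 : 0 ≤ K := by positivity
  have hwF : ∀ F : Finset ℕ, ∑ k ∈ F, K * w k ≤ K * ∑' k, w k := fun F => by
    rw [← Finset.mul_sum]
    exact mul_le_mul_of_nonneg_left (hw.sum_le_tsum F fun k _ => hw0 k) hK0
  refine strongBorelCantelliEstimate_of_covariance hf _
    (fun k => Metric.isOpen_ball.measurableSet) n₀
    (fun i k => K * w k + if (k : ℝ) ≤ g (m i) then v i ^ α else 0) (fun k => K * w k)
    (fun k => mul_nonneg hK0 (hw0 k)) (K * ∑' k, w k + G) ?_ ?_ ?_
  · intro i hi F hF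
    rw [Finset.sum_add_distrib]
    refine add_le_add (hwF F) ((sum_ite_le_window _ _ (Real.rpow_nonneg (hv0 i).le _) F hF).trans ?_)
    obtain ⟨h1, h2, -⟩ := hmi i hi
    have h3 := (hN₁ (m i) (by omega)).1
    calc v i ^ α * max (g (m i)) 0 ≤ v i ^ α * (G * (m i : ℝ) ^ α) :=
          mul_le_mul_of_nonneg_left (max_le h3 (by positivity)) (Real.rpow_nonneg (hv0 i).le _)
      _ = G * ((m i : ℝ) * v i) ^ α := by
          rw [Real.mul_rpow (by positivity) (hv0 i).le]; ring
      _ ≤ G * 1 := by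
          refine mul_le_mul_of_nonneg_left (Real.rpow_le_one ?_ h2 hα.le) hG
          exact mul_nonneg (by positivity) (hv0 i).le
      _ = G := mul_one G
  · intro F _
    linarith [hwF F]
  · intro i hi j hij
    obtain ⟨k, rfl⟩ := Nat.exists_eq_add_of_lt hij
    obtain ⟨h1, h2, h3, h4, h5⟩ := hmi i hi
    have hk : i + k + 1 - i = k + 1 := by omega
    rw [hk]
    set j := i + k + 1 with hj
    set l := k + 1 with hl
    change _ - v i * v j ≤ _ * v i + K * w l * v j
    have hrj : r j ≤ r i := hanti hij.le
    have hWj : 0 ≤ K * w l * v j := mul_nonneg (mul_nonneg hK0 (hw0 _)) (hv0 j).le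
    have hWi : 0 ≤ K * w l * v i := mul_nonneg (mul_nonneg hK0 (hw0 _)) (hv0 i).le
    have hvv : 0 ≤ v i * v j := mul_nonneg (hv0 i).le (hv0 j).le
    -- Short gaps: monotone radii allow `B_j` to be replaced by `B_i`, a genuine return. Long gaps:
    -- cutoffs of width `c l` and decay of correlations.
    by_cases hkg : (l : ℝ) ≤ g (m i)
    · have h6 := hN₀ (m i) (by omega) (r i) (hr i) h3 h4 l (by omega) hkg
      have h7 : ν.real (Metric.ball x (r i) ∩ f^[l] ⁻¹' Metric.ball x (r j)) ≤
          ν.real (Metric.ball x (r i) ∩ f^[l] ⁻¹' Metric.ball x (r i)) :=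
        measureReal_mono (Set.inter_subset_inter_right _
          (Set.preimage_mono (Metric.ball_subset_ball hrj)))
      change _ ≤ v i ^ (1 + α) at h6
      rw [Real.rpow_add (hv0 i), Real.rpow_one] at h6
      simp only [hkg, if_true]
      rw [add_mul]
      linarith
    · simp only [hkg, if_false, add_zero]
      obtain ⟨c1, c2, c3⟩ := (hN₁ (m i) (by omega)).2 l (by omega) (not_le.mp hkg)
      obtain ⟨hc0, hc1⟩ := hc l (by omega)
      have hlt : ∀ i' ≥ n₀, r i' < r₀ := by
        intro i' hi'
        by_contra hcon
        have := measureReal_ball_mono ν x (not_lt.mp hcon)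
        linarith [(hn₀ i' hi').1]
      have b1 := hann (r i) (c l) (hr i).le (hlt i hi) hc0
      have b2 := hann (r j) (c l) (hr j).le (hlt j (by omega)) hc0
      have b3 := hA1.measure_inter_le hf.measurable x (r i) (r j) hc0 l
      have b4 := mul_le_mul b1 b2 measureReal_nonneg
        (add_nonneg measureReal_nonneg (by positivity))
      change _ ≤ (v i + C * c l ^ δ) * (v j + C * c l ^ δ) at b4
      have b5 : Θ l * (1 + 1 / c l) ^ 2 ≤ 4 * (w l / m i) := by
        have : (1 + 1 / c l) ^ 2 ≤ 4 * (1 / c l ^ 2) := by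
          have e : 4 * (1 / c l ^ 2) = (2 * (1 / c l)) ^ 2 := by field_simp; norm_num
          rw [e]
          have : 1 ≤ 1 / c l := by rw [le_div_iff₀ hc0]; linarith
          gcongr
          linarith
        calc Θ l * (1 + 1 / c l) ^ 2 ≤ Θ l * (4 * (1 / c l ^ 2)) :=
              mul_le_mul_of_nonneg_left this (hA1.nonneg l)
          _ = 4 * (Θ l / c l ^ 2) := by ring
          _ ≤ _ := by linarith
      have b6 : w l / m i ≤ w l * (2 * v i) := by
        rw [div_eq_mul_one_div]
        exact mul_le_mul_of_nonneg_left h5 (hw0 l)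
      have p1 : v i * (C * c l ^ δ) ≤ v i * (C * w l) := by have := (hv0 i).le; gcongr
      have p2 : v j * (C * c l ^ δ) ≤ v j * (C * w l) := by have := (hv0 j).le; gcongr
      have p3 : C ^ 2 * (c l ^ δ * c l ^ δ) ≤ C ^ 2 * (w l * (2 * v i)) := by
        have := c2.trans b6
        gcongr
      have p4 : 0 ≤ (2 * C ^ 2 + 8) * (w l * v j) :=
        mul_nonneg (by positivity) (mul_nonneg (hw0 _) (hv0 _).le)
      have e1 : (v i + C * c l ^ δ) * (v j + C * c l ^ δ) = v i * v j + v i * (C * c l ^ δ) +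
        v j * (C * c l ^ δ) + C ^ 2 * (c l ^ δ * c l ^ δ) := by ring
      rw [e1] at b4
      have e2 : K * w l * v i + K * w l * v j = v i * (C * w l) + v j * (C * w l) +
        C ^ 2 * (w l * (2 * v i)) + 4 * (w l * (2 * v i)) + (2 * C ^ 2 + 8) * (w l * v j) := by
        rw [hK]; ring
      linarith

/-- Recurrence forbids a lack of short returns with exponent larger than one in a window longer than
the mean return time. -/
theorem not_lacksShortReturns_of_long_window {f : Y → Y} {ν : Measure Y} [IsProbabilityMeasure ν]
    (hf : MeasurePreserving f ν ν) {x : Y} {α : ℝ} (hα : 1 < α) {g : ℕ → ℝ}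
    (hg : ∀ᶠ n : ℕ in atTop, 4 * ((n : ℝ) + 1) ≤ g n)
    {t₀ : ℝ} (ht₀ : 0 < t₀) (hex : ∀ t : ℝ, 0 < t → t ≤ t₀ →
      ∃ ρ : ℝ, 0 < ρ ∧ t ≤ ν.real (Metric.ball x ρ) ∧ ν.real (Metric.ball x ρ) ≤ 2 * t) :
    ¬ LacksShortReturns f ν x α g := by
  intro hsr
  obtain ⟨N₀, hN₀⟩ := hsr.uniform ht₀ hex
  have hlim : Tendsto (fun n : ℕ => (2 * (1 / ((n : ℝ) + 1))) ^ (α - 1)) atTop (𝓝 0) := by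
    have h := (tendsto_one_div_add_atTop_nhds_zero_nat (𝕜 := ℝ)).const_mul 2
    rw [mul_zero] at h
    have h2 := h.rpow_const (p := α - 1) (Or.inr (by linarith))
    rwa [Real.zero_rpow (by linarith)] at h2
  obtain ⟨n, ⟨hn1, hn2⟩, hn3, hn4⟩ := ((hg.and (eventually_ge_atTop N₀)).and
    ((hlim.eventually_lt_const (by norm_num : (0 : ℝ) < 1 / 8)).and
    ((tendsto_one_div_add_atTop_nhds_zero_nat (𝕜 := ℝ)).eventually_le_const ht₀))).exists
  obtain ⟨ρ, hρ, h1, h2⟩ := hex _ (by positivity) hn4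
  have hgood := hN₀ n hn2 ρ hρ h1 h2
  set v := ν.real (Metric.ball x ρ) with hv
  -- Then `L v ≥ 4`, while `v^{α-1} < 1/8` makes each off-diagonal covariance at most `-7v²/8`. The
  -- variance over `L` steps would be at most `L v (1 - 7 L v / 8) < 0`.
  set L : ℕ := 4 * (n + 1) with hL
  have hLr : (L : ℝ) = 4 * ((n : ℝ) + 1) := by rw [hL]; push_cast; ring
  have hBm : MeasurableSet (Metric.ball x ρ) := Metric.isOpen_ball.measurableSet
  have hsq : 0 ≤ ∫ y, (∑ k ∈ Finset.range L,
      ((Metric.ball x ρ).indicator (fun _ => (1 : ℝ)) (f^[k] y) - v)) ^ 2 ∂ν :=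
    integral_nonneg fun _ => sq_nonneg _
  rw [integral_sq_sum_hits_eq hf (fun _ => Metric.ball x ρ) (fun _ => hBm)] at hsq
  have hn0 : (0 : ℝ) < n + 1 := by positivity
  have hv0 : 0 < v := lt_of_lt_of_le (by positivity) h1
  have hshort : ∀ i j, i < j → j < L → ν.real (f^[i] ⁻¹' Metric.ball x ρ ∩ f^[j] ⁻¹' Metric.ball x ρ)
      ≤ v ^ (1 + α) := by
    intro i j hij hj
    rw [measureReal_preimage_inter_preimage hf hBm hBm hij.le]
    refine hgood (j - i) (by omega) (le_trans ?_ hn1)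
    rw [← hLr]
    exact_mod_cast (by omega : j - i ≤ L)
  have hterm : ∀ i ∈ Finset.range L, ∀ j ∈ Finset.range L,
      ν.real (f^[i] ⁻¹' Metric.ball x ρ ∩ f^[j] ⁻¹' Metric.ball x ρ) - v * v ≤
        (if i = j then v else 0) + (v ^ (1 + α) - v * v) := by
    intro i hi j hj
    rw [Finset.mem_range] at hi hj
    rcases lt_trichotomy i j with h | h | h
    · simp only [h.ne, if_false]
      linarith [hshort i j h hj]
    · subst h
      rw [Set.inter_self, (hf.iterate i).measureReal_preimage hBm.nullMeasurableSet, if_pos rfl]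
      have : 0 ≤ v ^ (1 + α) := by positivity
      linarith
    · simp only [h.ne', if_false]
      rw [Set.inter_comm]
      linarith [hshort j i h hi]
  have hsum := hsq.trans (Finset.sum_le_sum fun i hi => Finset.sum_le_sum fun j hj => hterm i hi j hj)
  have hcalc : ∑ i ∈ Finset.range L, ∑ j ∈ Finset.range L,
      ((if i = j then v else 0) + (v ^ (1 + α) - v * v)) =
      L * v + L * (L * (v ^ (1 + α) - v * v)) := by
    simp only [Finset.sum_add_distrib, Finset.sum_const, Finset.card_range, nsmul_eq_mul]
    congr 1
    rw [Finset.sum_congr rfl fun i hi => by rw [Finset.sum_ite_eq, if_pos hi]]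
    simp
  rw [hcalc] at hsum
  have e : v ^ (1 + α) = v * (v * v ^ (α - 1)) := by
    rw [← Real.rpow_one_add' hv0.le (by linarith), ← Real.rpow_one_add' hv0.le (by linarith)]
    congr 1; ring
  have hpow : v ^ (α - 1) < 1 / 8 :=
    (Real.rpow_le_rpow hv0.le h2 (by linarith)).trans_lt hn3
  rw [e] at hsum
  have hLv : 4 ≤ L * v := by
    rw [div_le_iff₀ hn0] at h1
    rw [hLr]; linarith
  have hLv8 : L * v * v ^ (α - 1) ≤ L * v * (1 / 8) := by gcongr
  have hfac : L * v + L * (L * (v * (v * v ^ (α - 1)) - v * v)) =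
      L * v * (1 + (L * v * v ^ (α - 1)) - L * v) := by ring
  rw [hfac] at hsum
  have := nonneg_of_mul_nonneg_right hsum (by linarith)
  linarith

end

/-! ### Asymptotics of the measures and of the rates. -/

theorem eventually_mul_le_of_limsup_lt_top {Y : Type*} [MeasurableSpace Y] {ν : Measure Y}
    [IsProbabilityMeasure ν] (B : ℕ → Set Y) (u : ℕ → ℝ)
    (h : limsup (fun n : ℕ => ν (B n) * ENNReal.ofReal (u n)) atTop < ⊤) :
    ∃ M : ℝ, 0 ≤ M ∧ ∀ᶠ n in atTop, ν.real (B n) * u n ≤ M := by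
  obtain ⟨b, hb1, hb2⟩ := exists_between h
  refine ⟨b.toReal, ENNReal.toReal_nonneg, ?_⟩
  filter_upwards [eventually_lt_of_limsup_lt hb1] with n hn
  rcases le_or_gt (u n) 0 with hu | hu
  · exact (mul_nonpos_of_nonneg_of_nonpos measureReal_nonneg hu).trans ENNReal.toReal_nonneg
  · have := ENNReal.toReal_mono hb2.ne hn.le
    rwa [ENNReal.toReal_mul, ENNReal.toReal_ofReal hu.le] at this

theorem tendsto_zero_of_mul_le {v u : ℕ → ℝ} (hv : ∀ n, 0 ≤ v n) (hu : Tendsto u atTop atTop) {M : ℝ}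
    (h : ∀ᶠ n in atTop, v n * u n ≤ M) : Tendsto v atTop (𝓝 0) := by
  refine squeeze_zero' (Eventually.of_forall hv) ?_ (hu.const_div_atTop M)
  filter_upwards [h, hu.eventually_gt_atTop 0] with n h1 h2
  rwa [le_div_iff₀ h2]

theorem exponent_le_one_of_tendsto_sum {v : ℕ → ℝ} (hv : ∀ n, 0 ≤ v n) {s M : ℝ}
    (h : ∀ᶠ n : ℕ in atTop, v n * (n : ℝ) ^ s ≤ M)
    (hE : Tendsto (fun n => ∑ k ∈ Finset.Icc 1 n, v k) atTop atTop) : s ≤ 1 := by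
  by_contra hs
  rw [not_le] at hs
  have hsum : Summable v := by
    refine summable_of_isBigO_nat (Real.summable_one_div_nat_rpow.mpr hs) (IsBigO.of_bound M ?_)
    filter_upwards [h, eventually_ge_atTop 1] with n h1 h2
    have : (0 : ℝ) < n := by exact_mod_cast h2
    rw [Real.norm_of_nonneg (hv n), Real.norm_of_nonneg (by positivity), mul_one_div,
      le_div_iff₀ (by positivity)]
    exact h1
  obtain ⟨n, hn⟩ := (hE.eventually_gt_atTop (∑' k, v k)).exists
  exact hn.not_ge (hsum.sum_le_tsum _ fun k _ => hv k)

theorem exists_le_mul_of_isBigO {a b : ℕ → ℝ} (h : a =O[atTop] b) :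
    ∃ C : ℝ, 0 ≤ C ∧ ∀ n, 0 < b n → a n ≤ C * b n := by
  obtain ⟨C, hC, H⟩ := bound_of_isBigO_nat_atTop h
  refine ⟨C, hC.le, fun n hn => ?_⟩
  have := H hn.ne'
  rw [Real.norm_of_nonneg hn.le] at this
  exact (le_abs_self _).trans this

/-- This is where `γ > 1` matters: beyond the logarithmic window any exponential rate beats `1/n`.
-/
theorem eventually_exp_neg_log_rpow_le {μ γ : ℝ} (hμ : 0 < μ) (hγ : 1 < γ) :
    ∀ᶠ n : ℕ in atTop, Real.exp (-(μ * Real.log n ^ γ)) ≤ 1 / n := by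
  have hlog : Tendsto (fun n : ℕ => Real.log n) atTop atTop :=
    Real.tendsto_log_atTop.comp tendsto_natCast_atTop_atTop
  have h1 := (tendsto_rpow_atTop (by linarith : 0 < γ - 1)).comp hlog
  filter_upwards [h1.eventually_ge_atTop (1 / μ), hlog.eventually_gt_atTop 0,
    eventually_ge_atTop 1] with n h1 h2 h3
  have hn : (0 : ℝ) < n := by exact_mod_cast h3
  have h4 : Real.log n ^ γ = Real.log n * Real.log n ^ (γ - 1) := by
    rw [← Real.rpow_one_add' h2.le (by linarith)]; congr 1; ring
  simp only [Function.comp_apply] at h1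
  rw [div_le_iff₀ hμ] at h1
  rw [one_div, ← Real.exp_log (inv_pos.mpr hn), Real.log_inv, Real.exp_le_exp, h4, neg_le_neg_iff]
  nlinarith

/-! ### Choice of cutoff widths for exponential and polynomial decay. -/

section
variable {Y : Type*} [PseudoMetricSpace Y] [MeasurableSpace Y] [OpensMeasurableSpace Y]

theorem strongBorelCantelliEstimate_of_exponential_decay {f : Y → Y} {ν : Measure Y}
    [IsProbabilityMeasure ν] (hf : MeasurePreserving f ν ν) {x : Y} {δ : ℝ}
    (hA2 : AnnulusRegular ν x δ) (hpos : ∀ r : ℝ, 0 < r → 0 < ν.real (Metric.ball x r)) {Θ : ℕ → ℝ}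
    (hA1 : DecayOfCorrelations f ν Θ) {θ₀ : ℝ} (hθ0 : 0 < θ₀) (hθ1 : θ₀ < 1)
    (hΘ : Θ =O[atTop] (fun n : ℕ => θ₀ ^ n)) {α γ : ℝ} (hα : 0 < α) (hγ : 1 < γ)
    (hsr : LacksShortReturnsLog f ν x α γ) (r : ℕ → ℝ) (hr : ∀ n, 0 < r n) (hanti : Antitone r)
    (htend : Tendsto (fun n => ν.real (Metric.ball x (r n))) atTop (𝓝 0)) :
    StrongBorelCantelliEstimate f ν (fun n => Metric.ball x (r n)) := by
  have hδ := hA2.1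
  obtain ⟨C, hC, hΘC⟩ := exists_le_mul_of_isBigO hΘ
  set L := -Real.log θ₀ with hL
  have hL0 : 0 < L := neg_pos.mpr (Real.log_neg hθ0 hθ1)
  have hθL : ∀ k : ℕ, θ₀ ^ k = Real.exp (-(L * k)) := fun k => by
    rw [hL, neg_mul, neg_neg, mul_comm, Real.exp_nat_mul, Real.exp_log hθ0]
  -- For width `c = exp(-Lk/4)` and `e = exp(-μk)`, this gives `c^δ ≤ e` and `exp(-Lk) ≤ e² c²`. One
  -- factor `e` is summed, the other is at most `1/n` beyond the window.
  set μ := L * min 1 δ / 4 with hμ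
  have hμ0 : 0 < μ := by have := lt_min one_pos hδ; positivity
  have hμδ : μ ≤ L * δ / 4 := by
    have := mul_le_mul_of_nonneg_left (min_le_right 1 δ) hL0.le
    rw [hμ]; linarith
  have hμ1 : μ ≤ L / 4 := by
    have := mul_le_mul_of_nonneg_left (min_le_left 1 δ) hL0.le
    rw [hμ]; linarith
  have hg : ∀ᶠ n : ℕ in atTop, Real.log n ^ γ ≤ 1 * (n : ℝ) ^ α := by
    have h := ((isLittleO_log_rpow_rpow_atTop γ hα).bound one_pos)
    filter_upwards [tendsto_natCast_atTop_atTop.eventually h] with n hn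
    rw [Real.norm_of_nonneg (by positivity : (0 : ℝ) ≤ (n : ℝ) ^ α)] at hn
    exact (le_abs_self _).trans hn
  refine strongBorelCantelliEstimate_of_window hf hA2 hpos hA1 hα hsr 1 zero_le_one hg
    (fun k => (1 + C) * Real.exp (k * (-μ))) (fun k => Real.exp (-(L * k / 4)))
    ((Real.summable_exp_nat_mul_iff.mpr (neg_lt_zero.mpr hμ0)).mul_left _) (fun k => by positivity)
    (fun k _ => ⟨Real.exp_pos _, Real.exp_le_one_iff.mpr (by
      have : 0 ≤ L * k / 4 := by positivity
      linarith)⟩) ?_ r hr hanti htend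
  filter_upwards [eventually_exp_neg_log_rpow_le hμ0 hγ] with n hn k hk hkn
  set e := Real.exp (k * (-μ)) with he
  have he0 : 0 < e := Real.exp_pos _
  have hen : e ≤ 1 / n := by
    refine le_trans (Real.exp_le_exp.mpr ?_) hn
    nlinarith
  have hk0 : (0 : ℝ) ≤ k := by positivity
  have hcδ : Real.exp (-(L * k / 4)) ^ δ ≤ e := by
    rw [← Real.exp_mul, he, Real.exp_le_exp]
    nlinarith
  have hcδ0 : 0 ≤ Real.exp (-(L * k / 4)) ^ δ := by positivity
  have hCe : 0 ≤ C * e := by positivity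
  have hsq : e * e ≤ e / n := by
    rw [div_eq_mul_one_div]
    exact mul_le_mul_of_nonneg_left hen he0.le
  have hen0 : 0 ≤ e / n := by positivity
  have e1 : (1 + C) * e / n = e / n + C * (e / n) := by ring
  refine ⟨by linarith, ?_, ?_⟩
  · rw [e1]
    have := mul_le_mul hcδ hcδ hcδ0 he0.le
    have : 0 ≤ C * (e / n) := by positivity
    linarith
  · rw [div_le_iff₀ (by positivity)]
    have h1 := hΘC k (by positivity)
    rw [hθL] at h1
    have h2 : Real.exp (-(L * k)) ≤ e * e * Real.exp (-(L * k / 4)) ^ 2 := by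
      rw [he, ← Real.exp_add, ← Real.exp_nat_mul, ← Real.exp_add, Real.exp_le_exp]
      push_cast
      nlinarith
    calc Θ k ≤ C * Real.exp (-(L * k)) := h1
      _ ≤ C * (e / n * Real.exp (-(L * k / 4)) ^ 2) := by
          have : e * e * Real.exp (-(L * k / 4)) ^ 2 ≤ e / n * Real.exp (-(L * k / 4)) ^ 2 := by
            gcongr
          exact mul_le_mul_of_nonneg_left (h2.trans this) hC
      _ ≤ _ := by
          rw [e1]
          have : 0 ≤ e / n * Real.exp (-(L * k / 4)) ^ 2 := by positivity
          linarith

/-- With `q = 1/γ` and width `k^{-q/δ}`, the annulus error is `k^{-q}`: summable because `γ < 1`,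
and at most `1/n` because `k > n^γ`. The decay term `k^{-ζ+2q/δ}` factors as `k^{-q} k^{-(1+τ)}`,
and `τ > 0` is exactly the condition relating `γ` and `ζ`. -/
theorem strongBorelCantelliEstimate_of_polynomial_decay {f : Y → Y} {ν : Measure Y}
    [IsProbabilityMeasure ν] (hf : MeasurePreserving f ν ν) {x : Y} {δ : ℝ}
    (hA2 : AnnulusRegular ν x δ) (hpos : ∀ r : ℝ, 0 < r → 0 < ν.real (Metric.ball x r)) {Θ : ℕ → ℝ}
    (hA1 : DecayOfCorrelations f ν Θ) {ζ : ℝ}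
    (hΘ : Θ =O[atTop] (fun n : ℕ => (n : ℝ) ^ (-ζ))) {α γ : ℝ} (hγ0 : 0 < γ) (hγ1 : γ < 1)
    (hγα : γ ≤ α) (hγ : 2 * δ⁻¹ + 1 < γ * (ζ - 1))
    (hsr : LacksShortReturnsPoly f ν x α γ) (r : ℕ → ℝ) (hr : ∀ n, 0 < r n) (hanti : Antitone r)
    (htend : Tendsto (fun n => ν.real (Metric.ball x (r n))) atTop (𝓝 0)) :
    StrongBorelCantelliEstimate f ν (fun n => Metric.ball x (r n)) := by
  have hδ := hA2.1
  obtain ⟨C, hC, hΘC⟩ := exists_le_mul_of_isBigO hΘ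
  set q := γ⁻¹ with hq
  have hq1 : 1 < q := (one_lt_inv₀ hγ0).mpr hγ1
  set τ := ζ - 1 - q - 2 * (q / δ) with hτ
  have hτ0 : 0 < τ := by
    have h1 : γ * τ = γ * (ζ - 1) - (2 * δ⁻¹ + 1) := by
      rw [hτ, hq]; field_simp; ring
    exact pos_of_mul_pos_right (by rw [h1]; linarith) hγ0.le
  have hg : ∀ᶠ n : ℕ in atTop, (n : ℝ) ^ γ ≤ 1 * (n : ℝ) ^ α := by
    filter_upwards [eventually_ge_atTop 1] with n hn
    rw [one_mul]
    exact Real.rpow_le_rpow_of_exponent_le (by exact_mod_cast hn) hγα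
  have hw : Summable fun k : ℕ => (1 + C) * ((k : ℝ) ^ (-q) + (k : ℝ) ^ (-(1 + τ))) :=
    ((Real.summable_nat_rpow.mpr (by linarith)).add
      (Real.summable_nat_rpow.mpr (by linarith))).mul_left _
  refine strongBorelCantelliEstimate_of_window hf hA2 hpos hA1 (hγ0.trans_le hγα) hsr 1 zero_le_one
    hg _ (fun k => (k : ℝ) ^ (-(q / δ))) hw (fun k => by positivity) (fun k hk => ?_) ?_ r hr hanti
    htend
  · have hk' : (1 : ℝ) ≤ k := by exact_mod_cast hk
    have : 0 < q / δ := by positivity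
    exact ⟨by positivity, Real.rpow_le_one_of_one_le_of_nonpos hk' (by linarith)⟩
  filter_upwards [eventually_ge_atTop 1] with n hn k hk hkn
  have hn0 : (0 : ℝ) < n := by exact_mod_cast hn
  have hk0 : (0 : ℝ) < k := by exact_mod_cast hk
  have hcδ : ((k : ℝ) ^ (-(q / δ))) ^ δ = (k : ℝ) ^ (-q) := by
    rw [← Real.rpow_mul hk0.le]; congr 1; field_simp
  have hkq : (k : ℝ) ^ (-q) ≤ 1 / n := by
    rw [Real.rpow_neg hk0.le, ← one_div]
    refine one_div_le_one_div_of_le hn0 ?_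
    have := Real.rpow_le_rpow (by positivity) hkn.le (by positivity : 0 ≤ q)
    rwa [← Real.rpow_mul hn0.le, hq, mul_inv_cancel₀ hγ0.ne', Real.rpow_one] at this
  set a := (k : ℝ) ^ (-q) with ha
  set b := (k : ℝ) ^ (-(1 + τ)) with hb
  have ha0 : 0 < a := by positivity
  have hb0 : 0 < b := by positivity
  have hCa : 0 ≤ C * (a + b) := by positivity
  have han : 0 ≤ a / n := by positivity
  have hbn : 0 ≤ b / n := by positivity
  have e1 : (1 + C) * (a + b) / n = a / n + b / n + C * (a / n) + C * (b / n) := by ring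
  have p1 : 0 ≤ C * (a / n) := by positivity
  have p2 : 0 ≤ C * (b / n) := by positivity
  refine ⟨by rw [hcδ]; linarith, ?_, ?_⟩
  · rw [hcδ, e1]
    have : a * a ≤ a / n := by
      rw [div_eq_mul_one_div]
      exact mul_le_mul_of_nonneg_left hkq ha0.le
    linarith
  · have hsq : 0 < ((k : ℝ) ^ (-(q / δ))) ^ 2 := by positivity
    have hΘk : Θ k / ((k : ℝ) ^ (-(q / δ))) ^ 2 ≤ C * (a * b) := by
      rw [div_le_iff₀ hsq]
      refine (hΘC k (by positivity)).trans_eq ?_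
      rw [ha, hb, ← Real.rpow_natCast, ← Real.rpow_mul hk0.le, mul_assoc, ← Real.rpow_add hk0,
        ← Real.rpow_add hk0]
      congr 2
      rw [hτ]; push_cast; ring
    have h2 : a * b ≤ b / n := by
      rw [div_eq_mul_one_div, mul_comm]
      exact mul_le_mul_of_nonneg_left hkq hb0.le
    have h3 := mul_le_mul_of_nonneg_left h2 hC
    rw [e1]
    linarith

end

/-! ### The two cases of the theorem. -/

theorem proposition4p1 {d : ℕ} (X : Set (EuclideanSpace ℝ (Fin d))) (f : X → X)
    (ν : Measure X) [IsProbabilityMeasure ν] (hf : Ergodic f ν)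
    (x₀ : X) (D : ℝ) (hD : HasLocalDimension ν x₀ D)
    (δ : ℝ) (hA2 : AnnulusRegular ν x₀ δ)
    (Θ : ℕ → ℝ) (hA1 : DecayOfCorrelations f ν Θ) :
    -- exponential case
    (∀ θ₀ : ℝ, 0 < θ₀ → θ₀ < 1 → Θ =O[atTop] (fun n : ℕ => θ₀ ^ n) →
      ∀ α γ : ℝ, 0 < α → 1 < γ → LacksShortReturnsLog f ν x₀ α γ →
      ∀ r : ℕ → ℝ, (∀ n, 0 < r n) → Antitone r →
      ∀ σ : ℝ, 1 < σ →
      limsup (fun n : ℕ => ν (Metric.ball x₀ (r n)) * ENNReal.ofReal (Real.log n ^ (σ / α))) atTop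
        < ⊤ →
      StrongBorelCantelliEstimate f ν (fun n => Metric.ball x₀ (r n))) ∧
    -- polynomial case
    (∀ ζ : ℝ, 1 < ζ → Θ =O[atTop] (fun n : ℕ => (n : ℝ) ^ (-ζ)) →
      ∀ α γ : ℝ, 0 < α → (2 * δ⁻¹ + 1) / (ζ - 1) < γ → LacksShortReturnsPoly f ν x₀ α γ →
      ∀ r : ℕ → ℝ, (∀ n, 0 < r n) → Antitone r →
      ∀ σ : ℝ, (2 * δ⁻¹ + 1) / (ζ - 1) < σ →
      limsup (fun n : ℕ => ν (Metric.ball x₀ (r n)) * ENNReal.ofReal ((n : ℝ) ^ (σ / α))) atTop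
        < ⊤ →
      Tendsto (expectedHits ν (fun n => Metric.ball x₀ (r n))) atTop atTop →
      StrongBorelCantelliEstimate f ν (fun n => Metric.ball x₀ (r n))) := by
  have hfm := hf.toMeasurePreserving
  have hδ := hA2.1
  have hpos : ∀ r : ℝ, 0 < r → 0 < ν.real (Metric.ball x₀ r) := fun r hr =>
    ENNReal.toReal_pos (hD.1 r hr).ne' (measure_ne_top _ _)
  have hnat : Tendsto (fun n : ℕ => (n : ℝ)) atTop atTop := tendsto_natCast_atTop_atTop
  constructor
  · intro θ₀ hθ0 hθ1 hΘ α γ hα hγ hsr r hr hanti σ hσ hlim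
    obtain ⟨M, -, hM⟩ := eventually_mul_le_of_limsup_lt_top _ _ hlim
    exact strongBorelCantelliEstimate_of_exponential_decay hfm hA2 hpos hA1 hθ0 hθ1 hΘ hα hγ hsr r hr
      hanti (tendsto_zero_of_mul_le (fun _ => measureReal_nonneg)
        ((tendsto_rpow_atTop (by positivity : 0 < σ / α)).comp
          (Real.tendsto_log_atTop.comp hnat)) hM)
  · intro ζ hζ hΘ α γ hα hγ hsr r hr hanti σ hσ hlim hE
    obtain ⟨M, -, hM⟩ := eventually_mul_le_of_limsup_lt_top _ _ hlim
    set κ := (2 * δ⁻¹ + 1) / (ζ - 1) with hκ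
    have hζ1 : 0 < ζ - 1 := by linarith
    have hκ0 : 0 < κ := by positivity
    have hσ0 : 0 < σ := hκ0.trans hσ
    have htend : Tendsto (fun n => ν.real (Metric.ball x₀ (r n))) atTop (𝓝 0) :=
      tendsto_zero_of_mul_le (fun _ => measureReal_nonneg)
        ((tendsto_rpow_atTop (by positivity : 0 < σ / α)).comp hnat) hM
    -- Otherwise the measures would be summable, against `E_n → ∞`.
    have hσα : σ ≤ α := by
      have := exponent_le_one_of_tendsto_sum (fun _ => measureReal_nonneg) hM hE
      rwa [div_le_one hα] at this
    rcases lt_or_ge κ 1 with hκ1 | hκ1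
    -- Shrinking the window keeps short returns lacking. `γ' > κ` serves the decay term, `γ' < 1`
    -- the annulus error, and `γ' < σ ≤ α` the cost of the window.
    · obtain ⟨γ', h1, h2⟩ := exists_between (lt_min hκ1 (lt_min hγ hσ))
      obtain ⟨h3, h4⟩ := lt_min_iff.mp h2
      obtain ⟨h4, h5⟩ := lt_min_iff.mp h4
      refine strongBorelCantelliEstimate_of_polynomial_decay hfm hA2 hpos hA1 hΘ (hκ0.trans h1) h3
        (h5.le.trans hσα) ?_ (hsr.mono_window ?_) r hr hanti htend
      · rwa [hκ, div_lt_iff₀ hζ1] at h1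
      · filter_upwards [eventually_ge_atTop 1] with n hn
        exact Real.rpow_le_rpow_of_exponent_le (by exact_mod_cast hn) h4.le
    -- Here `α ≥ σ > κ ≥ 1` and `γ > κ ≥ 1`, so the window `n^γ` outgrows `4(n+1)` and recurrence
    -- gives a contradiction.
    · exfalso
      obtain ⟨r₀, hr₀, C, hC, hann⟩ := hA2.exists_annulus_le fun η hη => by
        obtain ⟨n, hn⟩ := (htend.eventually_lt_const hη).exists
        exact ⟨r n, hr n, hn⟩
      refine not_lacksShortReturns_of_long_window hfm (α := α) (by linarith) ?_ (hpos r₀ hr₀)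
        (fun t ht htr => exists_ball_measure_between hδ hC hann ht htr) hsr
      have h1 := (tendsto_rpow_atTop (by linarith : 0 < γ - 1)).comp hnat
      filter_upwards [h1.eventually_ge_atTop 8, eventually_ge_atTop 1] with n h2 h3
      have hn : (1 : ℝ) ≤ n := by exact_mod_cast h3
      have h4 : (n : ℝ) ^ γ = n * (n : ℝ) ^ (γ - 1) := by
        rw [← Real.rpow_one_add' (by linarith) (by linarith)]; congr 1; ring
      simp only [Function.comp_apply] at h2
      rw [h4]
      nlinarith
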